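/- Let $\mathcal M_d$ be the complex $d\times d$ matrices, $\mathbf 1_d$ the unit matrix, $\mathrm{id}_d$ the identity map and $\vartheta_d$ the matrix transposition on $\mathcal M_d$. A linear map $P:\mathcal M_{d_A}\to\mathcal M_{d_B}$ is *positive* if it maps positive semidefinite matrices to positive semidefinite matrices, *completely positive* (CP) if $\mathrm{id}_k\otimes P$ is positive for every $k$, *completely copositive* (coCP) if $\vartheta_k\otimes P$ is positive for every $k$, and *decomposable* if $P=T_1+\vartheta_{d_B}\circ T_2$ with $T_1,T_2$ CP. Its Choi matrix is $C_P=(\mathrm{id}_{d_A}\otimes P)(\omega_{d_A})$ with $\omega_d=|\Omega_d\rangle\langle\Omega_d|$, $|\Omega_d\rangle=\sum_{i=1}^d|i\rangle\otimes|i\rangle$. For a non-zero positive map $P$ put $$\mu(P)=\inf\Big\{\frac{\mathrm{Tr}[C_PC_T]}{\mathrm{Tr}[(T^*\circ P)(\mathbf 1_{d_A})]}\ :\ T:\mathcal M_{d_A}\to\mathcal M_{d_B}\text{ CP},\ (T^*\circ P)(\mathbf 1_{d_A})\neq 0\Big\},$$ where $T^*$ is the adjoint of $T$ for the Hilbert–Schmidt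 inner product $\langle A,B\rangle=\mathrm{Tr}[A^\dagger B]$. The Werner map $W_p:\mathcal M_d\to\mathcal M_d$ is the linear map with Choi matrix $C_{W_p}=p\,\frac{P_{\mathrm{sym}}}{\mathrm{Tr} P_{\mathrm{sym}}}+(1-p)\frac{P_{\mathrm{asym}}}{\mathrm{Tr} P_{\mathrm{asym}}}$, where $P_{\mathrm{sym}}=\frac12(\mathbf 1+\mathbb F_d)$, $P_{\mathrm{asym}}=\frac12(\mathbf 1-\mathbb F_d)$ and $\mathbb F_d(|i\rangle\otimes|j\rangle)=|j\rangle\otimes|i\rangle$. A *mapping cone* is a system $\mathcal C=\{\mathcal C_{n,m}\}_{n,m}$ of closed convex cones $\mathcal C_{n,m}$ of positive maps $\mathcal M_n\to\mathcal M_m$ such that $S\circ P\circ T\in\mathcal C_{n',m'}$ for all $P\in\mathcal C_{n,m}$ and all CP maps $T:\mathcal M_{n'}\to\mathcal M_n$, $S:\mathcal M_m\to\mathcal M_{m'}$. For $P:\mathcal M_n\to\mathcal M_m$ one writes $P\in\mathcal C$ for $P\in\mathcal C_{n,m}$; tensor powers $\mathcal M_d^{\otimes N}$ are identified with $\mathcal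 M_{d^N}$. **Theorem.** Let $\mathcal C$ be a mapping cone and $P:\mathcal M_{d_A}\to\mathcal M_{d_B}$ a positive map that is neither CP nor coCP. If $P^{\otimes N}\in\mathcal C$ for some $N\in\mathbb N$, then for all integers $n,m\ge 0$ with $n+m\le N$ and all real $p_1,p_2$ with $$\tfrac12\big(1+\mu(\vartheta_{d_B}\circ P)\big)<p_1<\tfrac12,\qquad \tfrac12\big(1+\mu(P)\big)<p_2<\tfrac12,$$ the Werner maps $W_{p_1},W_{p_2}:\mathcal M_{d_A}\to\mathcal M_{d_A}$ satisfy $$W_{p_1}^{\otimes n}\otimes(\vartheta_{d_A}\circ W_{p_2})^{\otimes m}\in\mathcal C .$$ **Corollary.** The decomposable maps form a mapping cone. Consequently, if $P$ is a positive map that is neither CP nor coCP and $P^{\otimes N}$ is decomposable, then $W_{p_1}^{\otimes n}\otimes(\vartheta_{d_A}\circ W_{p_2})^{\otimes m}$ is decomposable for all such $n,m$ and $p_1,p_2$. -/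

import Mathlib

open scoped Kronecker ComplexOrder

/-- `M_d`, the complex `d × d` matrices. -/
abbrev Mat (d : ℕ) : Type := Matrix (Fin d) (Fin d) ℂ

namespace MatMap

section Tensor

variable {a b c e : Type} [Fintype a] [DecidableEq a] [Fintype c] [DecidableEq c]

/-- The tensor product `L ⊗ L'` of linear maps between matrix algebras, where `M_a ⊗ M_c` is
identified with the matrices over `a × c` through the Kronecker product. -/
noncomputable def tensorMap (L : Matrix a a ℂ →ₗ[ℂ] Matrix b b ℂ)
    (L' : Matrix c c ℂ →ₗ[ℂ] Matrix e e ℂ) :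
    Matrix (a × c) (a × c) ℂ →ₗ[ℂ] Matrix (b × e) (b × e) ℂ where
  toFun X := ∑ p, ∑ q,
    X p q • (L (Matrix.single p.1 q.1 1) ⊗ₖ L' (Matrix.single p.2 q.2 1))
  map_add' X Y := by simp [add_smul, Finset.sum_add_distrib]
  map_smul' r X := by simp [mul_smul, Finset.smul_sum]

/-- The tensor product `L₁ ⊗ ⋯ ⊗ L_N` of a finite family of linear maps, where `M_a^{⊗ N}` is
identified with the matrices over `Fin N → a`. -/
noncomputable def piTensorMap {N : ℕ} (L : Fin N → (Matrix a a ℂ →ₗ[ℂ] Matrix b b ℂ)) :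
    Matrix (Fin N → a) (Fin N → a) ℂ →ₗ[ℂ] Matrix (Fin N → b) (Fin N → b) ℂ where
  toFun X := ∑ i, ∑ j,
    X i j • Matrix.of fun k l => ∏ s, L s (Matrix.single (i s) (j s) 1) (k s) (l s)
  map_add' X Y := by
    ext k l
    simp [add_mul, Matrix.sum_apply, Finset.sum_add_distrib]
  map_smul' r X := by
    ext k l
    simp [mul_assoc, Matrix.sum_apply, Finset.mul_sum]

/-- A linear map is determined by its values on matrix units. -/
theorem apply_entry (L : Matrix a a ℂ →ₗ[ℂ] Matrix b b ℂ) (X : Matrix a a ℂ) (k l : b) :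
    L X k l = ∑ i, ∑ j, X i j * L (Matrix.single i j 1) k l := by
  conv_lhs => rw [Matrix.matrix_eq_sum_single X]
  simp only [map_sum, Matrix.sum_apply]
  refine Finset.sum_congr rfl fun i _ => Finset.sum_congr rfl fun j _ => ?_
  have h : Matrix.single i j (X i j) = X i j • Matrix.single i j (1 : ℂ) := by simp
  rw [h, map_smul]
  simp

/-- The defining property of `L ⊗ L'`. -/
theorem tensorMap_kronecker (L : Matrix a a ℂ →ₗ[ℂ] Matrix b b ℂ)
    (L' : Matrix c c ℂ →ₗ[ℂ] Matrix e e ℂ) (X : Matrix a a ℂ) (Y : Matrix c c ℂ) :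
    tensorMap L L' (X ⊗ₖ Y) = L X ⊗ₖ L' Y := by
  ext ⟨k, k'⟩ ⟨l, l'⟩
  simp only [tensorMap, LinearMap.coe_mk, AddHom.coe_mk, Matrix.sum_apply, Matrix.smul_apply,
    Matrix.kroneckerMap_apply, smul_eq_mul]
  rw [apply_entry L X, apply_entry L' Y, Fintype.sum_prod_type, Finset.sum_mul]
  refine Finset.sum_congr rfl fun i _ => ?_
  rw [Finset.mul_sum]
  refine Finset.sum_congr rfl fun i' _ => ?_
  rw [Fintype.sum_prod_type, Finset.sum_mul]
  refine Finset.sum_congr rfl fun j _ => ?_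
  rw [Finset.mul_sum]
  exact Finset.sum_congr rfl fun j' _ => by ring

/-- The defining property of `L₁ ⊗ ⋯ ⊗ L_N`. -/
theorem piTensorMap_prod {N : ℕ} (L : Fin N → (Matrix a a ℂ →ₗ[ℂ] Matrix b b ℂ))
    (X : Fin N → Matrix a a ℂ) :
    piTensorMap L (Matrix.of fun i j => ∏ s, X s (i s) (j s)) =
      Matrix.of fun k l => ∏ s, L s (X s) (k s) (l s) := by
  ext k l
  simp only [piTensorMap, LinearMap.coe_mk, AddHom.coe_mk, Matrix.sum_apply, Matrix.smul_apply,
    Matrix.of_apply, smul_eq_mul, ← Finset.prod_mul_distrib]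
  simp only [apply_entry _ (X _), Finset.prod_univ_sum, Fintype.piFinset_univ]

end Tensor

/-- `ϑ_d`, the matrix transposition in the computational basis. -/
def transposeMap (d : ℕ) : Mat d →ₗ[ℂ] Mat d :=
  (Matrix.transposeLinearEquiv (Fin d) (Fin d) ℂ ℂ).toLinearMap

/-- Positive maps. -/
def IsPositive {dA dB : ℕ} (P : Mat dA →ₗ[ℂ] Mat dB) : Prop :=
  ∀ X : Mat dA, X.PosSemidef → (P X).PosSemidef

/-- Completely positive maps: `id_k ⊗ P` is positive for every `k`. -/
def IsCP {dA dB : ℕ} (P : Mat dA →ₗ[ℂ] Mat dB) : Prop :=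
  ∀ (k : ℕ) (X : Matrix (Fin k × Fin dA) (Fin k × Fin dA) ℂ), X.PosSemidef →
    (tensorMap (LinearMap.id : Mat k →ₗ[ℂ] Mat k) P X).PosSemidef

/-- Completely copositive maps: `ϑ_k ⊗ P` is positive for every `k`. -/
def IsCoCP {dA dB : ℕ} (P : Mat dA →ₗ[ℂ] Mat dB) : Prop :=
  ∀ (k : ℕ) (X : Matrix (Fin k × Fin dA) (Fin k × Fin dA) ℂ), X.PosSemidef →
    (tensorMap (transposeMap k) P X).PosSemidef

/-- Decomposable maps. -/
def IsDecomposable {dA dB : ℕ} (P : Mat dA →ₗ[ℂ] Mat dB) : Prop :=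
  ∃ T₁ T₂ : Mat dA →ₗ[ℂ] Mat dB, IsCP T₁ ∧ IsCP T₂ ∧ P = T₁ + transposeMap dB ∘ₗ T₂

/-- The unnormalized maximally entangled vector `Ω_d = ∑ᵢ |i⟩ ⊗ |i⟩`. -/
def maxEntVec (d : ℕ) : Fin d × Fin d → ℂ := fun p => if p.1 = p.2 then 1 else 0

/-- The unnormalized maximally entangled state `ω_d = |Ω_d⟩⟨Ω_d|`. -/
noncomputable def maxEnt (d : ℕ) : Matrix (Fin d × Fin d) (Fin d × Fin d) ℂ :=
  Matrix.vecMulVec (maxEntVec d) (star (maxEntVec d))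

/-- The Choi matrix `C_L = (id ⊗ L)(ω)`. -/
noncomputable def choi {dA dB : ℕ} (L : Mat dA →ₗ[ℂ] Mat dB) :
    Matrix (Fin dA × Fin dB) (Fin dA × Fin dB) ℂ :=
  tensorMap (LinearMap.id : Mat dA →ₗ[ℂ] Mat dA) L (maxEnt dA)

/-- The linear map with a given Choi matrix (see `choi_ofChoi`). -/
noncomputable def ofChoi {dA dB : ℕ} (C : Matrix (Fin dA × Fin dB) (Fin dA × Fin dB) ℂ) :
    Mat dA →ₗ[ℂ] Mat dB where
  toFun X := Matrix.of fun k l => ∑ i, ∑ j, X i j * C (i, k) (j, l)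
  map_add' X Y := by ext; simp [add_mul, Finset.sum_add_distrib]
  map_smul' r X := by ext; simp [mul_assoc, Finset.mul_sum]

theorem choi_apply {dA dB : ℕ} (L : Mat dA →ₗ[ℂ] Mat dB) (i j : Fin dA) (k l : Fin dB) :
    choi L (i, k) (j, l) = L (Matrix.single i j 1) k l := by
  have h : maxEnt dA = ∑ x, ∑ y,
      ((Matrix.single x y (1 : ℂ) : Mat dA) ⊗ₖ (Matrix.single x y (1 : ℂ) : Mat dA)) := by
    ext ⟨x, x'⟩ ⟨y, y'⟩
    have h2 : ∀ u v : Fin dA,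
        ((Matrix.single u v (1 : ℂ) : Mat dA) ⊗ₖ (Matrix.single u v (1 : ℂ) : Mat dA))
          (x, x') (y, y') =
        if u = x then (if v = y then (if x = x' then (if y = y' then 1 else 0) else 0) else 0)
          else 0 := by
      intro u v
      simp only [Matrix.kroneckerMap_apply, Matrix.single_apply]
      split_ifs <;> simp_all
    simp only [Matrix.sum_apply, h2]
    by_cases hx : x = x' <;> by_cases hy : y = y' <;>
      simp [maxEnt, maxEntVec, Matrix.vecMulVec_apply, hx, hy]
  rw [choi, h]
  simp [map_sum, tensorMap_kronecker, Matrix.sum_apply, Matrix.single_apply, ite_and]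

theorem choi_ofChoi {dA dB : ℕ} (C : Matrix (Fin dA × Fin dB) (Fin dA × Fin dB) ℂ) :
    choi (ofChoi C) = C := by
  ext ⟨i, k⟩ ⟨j, l⟩
  simp [choi_apply, ofChoi, Matrix.single_apply, ite_and]

theorem choi_injective {dA dB : ℕ} :
    Function.Injective (choi : (Mat dA →ₗ[ℂ] Mat dB) → _) := by
  intro L L' h
  refine LinearMap.ext fun X => ?_
  ext k l
  simp only [apply_entry L X, apply_entry L' X, ← choi_apply, h]

/-- The adjoint `T*` with respect to the Hilbert-Schmidt inner product `⟨A, B⟩ = Tr[A† B]`. -/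
noncomputable def hsAdjoint {dA dB : ℕ} (T : Mat dA →ₗ[ℂ] Mat dB) : Mat dB →ₗ[ℂ] Mat dA where
  toFun Y := Matrix.of fun i j => ((T (Matrix.single i j 1)).conjTranspose * Y).trace
  map_add' X Y := by ext; simp [mul_add]
  map_smul' r X := by ext; simp

/-- `⟨T X, Y⟩ = ⟨X, T* Y⟩`. -/
theorem hsAdjoint_spec {dA dB : ℕ} (T : Mat dA →ₗ[ℂ] Mat dB) (X : Mat dA) (Y : Mat dB) :
    ((T X).conjTranspose * Y).trace = (X.conjTranspose * hsAdjoint T Y).trace := by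
  have key' : ∀ (A B : Mat dA),
      (A.conjTranspose * B).trace = ∑ j, ∑ i, star (A i j) * B i j := by
    intro A B
    simp [Matrix.trace, Matrix.mul_apply]
  have h : (T X).conjTranspose =
      ∑ i, ∑ j, star (X i j) • (T (Matrix.single i j 1)).conjTranspose := by
    ext k l
    simp [apply_entry T X, Matrix.sum_apply]
  rw [key', h, Finset.sum_comm]
  simp [Finset.sum_mul, Matrix.trace_sum, hsAdjoint]

/-- `μ(P)`: the infimum of `Tr[C_P C_T] / Tr[(T* ∘ P)(1)]` over the completely positive maps `T`
with `(T* ∘ P)(1) ≠ 0`. For positive `P` both traces are real numbers. -/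
noncomputable def mu {dA dB : ℕ} (P : Mat dA →ₗ[ℂ] Mat dB) : ℝ :=
  sInf {r : ℝ | ∃ T : Mat dA →ₗ[ℂ] Mat dB, IsCP T ∧ (hsAdjoint T ∘ₗ P) 1 ≠ 0 ∧
    r = (choi P * choi T).trace.re / ((hsAdjoint T ∘ₗ P) 1).trace.re}

/-- The flip operator `F_d (|i⟩ ⊗ |j⟩) = |j⟩ ⊗ |i⟩`. -/
def flip (d : ℕ) : Matrix (Fin d × Fin d) (Fin d × Fin d) ℂ :=
  Matrix.of fun p q => if p.1 = q.2 ∧ p.2 = q.1 then 1 else 0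

/-- The projector onto the symmetric subspace. -/
noncomputable def symProj (d : ℕ) : Matrix (Fin d × Fin d) (Fin d × Fin d) ℂ :=
  (1 / 2 : ℂ) • (1 + flip d)

/-- The projector onto the antisymmetric subspace. -/
noncomputable def asymProj (d : ℕ) : Matrix (Fin d × Fin d) (Fin d × Fin d) ℂ :=
  (1 / 2 : ℂ) • (1 - flip d)

/-- The Werner state `ρ_W(p)`. -/
noncomputable def wernerState (d : ℕ) (p : ℝ) : Matrix (Fin d × Fin d) (Fin d × Fin d) ℂ :=
  ((p : ℂ) / (symProj d).trace) • symProj d +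
    ((1 - (p : ℂ)) / (asymProj d).trace) • asymProj d

/-- The Werner map `W_p`, the linear map with Choi matrix `ρ_W(p)`. -/
noncomputable def wernerMap (d : ℕ) (p : ℝ) : Mat d →ₗ[ℂ] Mat d := ofChoi (wernerState d p)

/-- `L₁ ⊗ ⋯ ⊗ L_N` as a map from `M_{a^N}` to `M_{b^N}`, after a fixed enumeration of the
product bases. -/
noncomputable def tensorFamily {a b N : ℕ} (L : Fin N → (Mat a →ₗ[ℂ] Mat b)) :
    Mat (a ^ N) →ₗ[ℂ] Mat (b ^ N) :=
  (Matrix.reindexLinearEquiv ℂ ℂ (finFunctionFinEquiv (m := b) (n := N))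
      (finFunctionFinEquiv (m := b) (n := N))).toLinearMap ∘ₗ piTensorMap L ∘ₗ
    (Matrix.reindexLinearEquiv ℂ ℂ (finFunctionFinEquiv (m := a) (n := N))
      (finFunctionFinEquiv (m := a) (n := N))).symm.toLinearMap

/-- The tensor power `P^{⊗ N}`. -/
noncomputable def tensorPower {a b : ℕ} (N : ℕ) (P : Mat a →ₗ[ℂ] Mat b) :
    Mat (a ^ N) →ₗ[ℂ] Mat (b ^ N) :=
  tensorFamily fun _ : Fin N => P

/-- The mixed tensor power `W_{p₁}^{⊗ n} ⊗ (ϑ_d ∘ W_{p₂})^{⊗ m}`. -/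
noncomputable def mixedWerner (d n m : ℕ) (p₁ p₂ : ℝ) :
    Mat (d ^ (n + m)) →ₗ[ℂ] Mat (d ^ (n + m)) :=
  tensorFamily (Fin.append (fun _ : Fin n => wernerMap d p₁)
    (fun _ : Fin m => transposeMap d ∘ₗ wernerMap d p₂))

/-- Mapping cones: systems of closed convex cones of positive maps that are stable under
composition with completely positive maps from both sides. Closedness refers to pointwise
convergence, which gives the usual topology of the finite-dimensional space of linear maps. -/
structure IsMappingCone (C : ∀ n m : ℕ, ConvexCone ℝ (Mat n →ₗ[ℂ] Mat m)) : Prop where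
  positive : ∀ {n m : ℕ} (P : Mat n →ₗ[ℂ] Mat m), P ∈ C n m → IsPositive P
  closed : ∀ n m : ℕ,
    IsClosed ((fun P : Mat n →ₗ[ℂ] Mat m => (P : Mat n → Mat m)) ''
      (C n m : Set (Mat n →ₗ[ℂ] Mat m)))
  comp_mem : ∀ {n m n' m' : ℕ} (P : Mat n →ₗ[ℂ] Mat m) (T : Mat n' →ₗ[ℂ] Mat n)
    (S : Mat m →ₗ[ℂ] Mat m'), P ∈ C n m → IsCP T → IsCP S → S ∘ₗ P ∘ₗ T ∈ C n' m'

section Helpers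

variable {a b c e : Type} [Fintype a] [DecidableEq a] [Fintype c] [DecidableEq c]

theorem tensorMap_add_right (L : Matrix a a ℂ →ₗ[ℂ] Matrix b b ℂ)
    (L₁ L₂ : Matrix c c ℂ →ₗ[ℂ] Matrix e e ℂ) (X : Matrix (a × c) (a × c) ℂ) :
    tensorMap L (L₁ + L₂) X = tensorMap L L₁ X + tensorMap L L₂ X := by
  simp [tensorMap, Matrix.kronecker_add, Finset.sum_add_distrib]

theorem tensorMap_smul_right (L : Matrix a a ℂ →ₗ[ℂ] Matrix b b ℂ)
    (L₁ : Matrix c c ℂ →ₗ[ℂ] Matrix e e ℂ) (r : ℝ) (X : Matrix (a × c) (a × c) ℂ) :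
    tensorMap L (r • L₁) X = r • tensorMap L L₁ X := by
  simp [tensorMap, Matrix.kronecker_smul, Finset.smul_sum, smul_comm r]

end Helpers

theorem IsCP.add {dA dB : ℕ} {S T : Mat dA →ₗ[ℂ] Mat dB} (hS : IsCP S) (hT : IsCP T) :
    IsCP (S + T) := fun k X hX => by
  rw [tensorMap_add_right]
  exact (hS k X hX).add (hT k X hX)

theorem IsCP.smul {dA dB : ℕ} {T : Mat dA →ₗ[ℂ] Mat dB} (hT : IsCP T) {r : ℝ} (hr : 0 ≤ r) :
    IsCP (r • T) := fun k X hX => by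
  rw [tensorMap_smul_right]
  exact (hT k X hX).smul hr

/-- The system of the cones of decomposable maps. -/
def decomposableCone (n m : ℕ) : ConvexCone ℝ (Mat n →ₗ[ℂ] Mat m) where
  carrier := {P | IsDecomposable P}
  smul_mem' := by
    rintro r hr _ ⟨T₁, T₂, h₁, h₂, rfl⟩
    refine ⟨r • T₁, r • T₂, h₁.smul hr.le, h₂.smul hr.le, ?_⟩
    refine LinearMap.ext fun X => ?_
    ext k l
    simp [transposeMap]
  add_mem' := by
    rintro _ ⟨T₁, T₂, h₁, h₂, rfl⟩ _ ⟨S₁, S₂, g₁, g₂, rfl⟩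
    refine ⟨T₁ + S₁, T₂ + S₂, h₁.add g₁, h₂.add g₂, ?_⟩
    rw [LinearMap.comp_add]
    abel

end MatMap

namespace MatMap

section Sums

variable {V₁ V₂ V₃ ι : Type} [AddCommMonoid V₁] [AddCommMonoid V₂] [AddCommMonoid V₃]
  [Module ℂ V₁] [Module ℂ V₂] [Module ℂ V₃]

/-! Write `Reach P L` when `L` is a finite sum of maps `X ↦ A P(B X B†) A†`. A mapping cone
containing `P` contains every `L` reached from `P` (`IsMappingCone.mem_of_reach`). Reachability is
transitive and multiplicative under tensor products (`reach_piTensorMap`), and a tensor factor can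
be discarded when `Tr P(1) > 0` (`reach_tensorPower_succ`). The theorem thus reduces to a single
tensor factor: `P` reaches `ϑ ∘ W_{p₂}` and `W_{p₁}`.

For the first, the quotient defining `μ(P)` is a quotient of two linear functionals of `L = T* ∘ P`:
the trace of `L` as an operator on matrices (`superTrace`) and `Tr L(1)` (`traceOne`). Twirling `L`
makes it isotropic, `X ↦ α X + β Tr(X) 1`, and multiplies both functionals by the same positive
number (`exists_reach_isotropic`), so they determine the result. The twirl must be a finite sum,
hence it uses monomial unitaries and one Fourier conjugation instead of the Haar measure. Now `ϑ ∘
W_p` is the isotropic map with functionals `2p - 1` and `1`. If `T` has quotient `r < 2p - 1 < 0`,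
then `ϑ ∘ W_p` is a nonnegative combination of the twirled `T* ∘ P` and `X ↦ Tr(X) 1`, both reached
from `P` (`IsPositive.reach_werner`).

For `W_{p₁}` the same argument is applied to `ϑ ∘ P`, and the transposition is moved through the
conjugations (`Reach.of_transposeMap_comp`).

For the corollary, decomposability of `P` means that its Choi matrix is `A` plus a partial transpose
of `B` with `A`, `B` positive semidefinite. Partial transposition preserves the trace, so near a
limit point `A` and `B` range over a compact set, which gives closedness. -/

theorem linearMap_comp_sum (s : Finset ι) (f : V₂ →ₗ[ℂ] V₃) (g : ι → (V₁ →ₗ[ℂ] V₂)) :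
    f ∘ₗ (∑ x ∈ s, g x) = ∑ x ∈ s, f ∘ₗ g x :=
  LinearMap.ext fun X => by simp

theorem sum_linearMap_comp (s : Finset ι) (f : V₁ →ₗ[ℂ] V₂) (g : ι → (V₂ →ₗ[ℂ] V₃)) :
    (∑ x ∈ s, g x) ∘ₗ f = ∑ x ∈ s, g x ∘ₗ f :=
  LinearMap.ext fun X => by simp

end Sums

/-! ### Conjugation maps, the Choi criterion and Kraus decompositions. -/

section Conj

variable {l m n : Type} [Fintype n]

/-- The completely positive map `X ↦ K X K†` with the single Kraus operator `K`. -/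
noncomputable def conjMap (K : Matrix m n ℂ) : Matrix n n ℂ →ₗ[ℂ] Matrix m m ℂ where
  toFun X := K * X * K.conjTranspose
  map_add' X Y := by simp [Matrix.mul_add, Matrix.add_mul]
  map_smul' r X := by simp

theorem conjMap_apply (K : Matrix m n ℂ) (X : Matrix n n ℂ) :
    conjMap K X = K * X * K.conjTranspose := rfl

theorem conjMap_apply_entry (K : Matrix m n ℂ) (X : Matrix n n ℂ) (k k' : m) :
    conjMap K X k k' = ∑ i, ∑ j, K k i * X i j * star (K k' j) := by
  simp only [conjMap_apply, Matrix.mul_apply, Matrix.conjTranspose_apply, Finset.sum_mul]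
  rw [Finset.sum_comm]

theorem conjMap_comp_conjMap [Fintype m] (K : Matrix l m ℂ) (K' : Matrix m n ℂ) :
    conjMap K ∘ₗ conjMap K' = conjMap (K * K') := by
  refine LinearMap.ext fun X => ?_
  simp [conjMap_apply, Matrix.mul_assoc]

theorem conjMap_zero : conjMap (0 : Matrix m n ℂ) = 0 := by
  refine LinearMap.ext fun X => ?_
  simp [conjMap_apply]

theorem conjMap_one [DecidableEq n] : conjMap (1 : Matrix n n ℂ) = LinearMap.id := by
  refine LinearMap.ext fun X => ?_
  simp [conjMap_apply]

theorem conjMap_one_submatrix [DecidableEq n] (e : m → n) (X : Matrix n n ℂ) :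
    conjMap ((1 : Matrix n n ℂ).submatrix e id) X = X.submatrix e e := by
  ext k l
  simp [conjMap_apply_entry, Matrix.one_apply]

theorem conjMap_real_smul (c : ℝ) (K : Matrix m n ℂ) :
    conjMap ((c : ℂ) • K) = (c ^ 2) • conjMap K := by
  refine LinearMap.ext fun X => ?_
  ext i j
  simp [conjMap_apply]
  ring

theorem conjMap_posSemidef [Finite m] (K : Matrix m n ℂ) {X : Matrix n n ℂ} (hX : X.PosSemidef) :
    (conjMap K X).PosSemidef :=
  hX.mul_mul_conjTranspose_same K

theorem conjMap_map_star (K : Matrix m n ℂ) (X : Matrix n n ℂ) :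
    conjMap (K.map star) X.transpose = (conjMap K X).transpose := by
  ext i j
  simp only [Matrix.transpose_apply, conjMap_apply_entry, Matrix.map_apply, star_star]
  rw [Finset.sum_comm]
  exact Finset.sum_congr rfl fun _ _ => Finset.sum_congr rfl fun _ _ => by ring

end Conj

theorem transposeMap_apply {d : ℕ} (X : Mat d) : transposeMap d X = X.transpose := rfl

theorem transposeMap_comp_conjMap {a b : ℕ} (K : Matrix (Fin b) (Fin a) ℂ) :
    transposeMap b ∘ₗ conjMap K = conjMap (K.map star) ∘ₗ transposeMap a :=
  LinearMap.ext fun X => (conjMap_map_star K X).symm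

theorem tensorMap_id_conjMap {k a b : ℕ} (K : Matrix (Fin b) (Fin a) ℂ)
    (X : Matrix (Fin k × Fin a) (Fin k × Fin a) ℂ) :
    tensorMap (LinearMap.id : Mat k →ₗ[ℂ] Mat k) (conjMap K) X =
      conjMap ((1 : Mat k) ⊗ₖ K) X := by
  conv_rhs => rw [Matrix.matrix_eq_sum_single X]
  simp only [map_sum]
  simp only [tensorMap, LinearMap.coe_mk, AddHom.coe_mk]
  refine Finset.sum_congr rfl fun p _ => Finset.sum_congr rfl fun q _ => ?_
  have h : Matrix.single p q (X p q) = X p q • ((Matrix.single p.1 q.1 (1 : ℂ) : Mat k) ⊗ₖ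
      (Matrix.single p.2 q.2 (1 : ℂ) : Mat a)) := by
    rw [Matrix.single_kronecker_single]; simp
  rw [h, map_smul]
  simp only [conjMap_apply, Matrix.conjTranspose_kronecker, ← Matrix.mul_kronecker_mul]
  simp

theorem isCP_conjMap {a b : ℕ} (K : Matrix (Fin b) (Fin a) ℂ) : IsCP (conjMap K) := by
  intro k X hX
  rw [tensorMap_id_conjMap]
  exact conjMap_posSemidef _ hX

theorem isCP_zero {a b : ℕ} : IsCP (0 : Mat a →ₗ[ℂ] Mat b) :=
  conjMap_zero (m := Fin b) (n := Fin a) ▸ isCP_conjMap 0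

theorem isCP_sum {a b : ℕ} {ι : Type} (s : Finset ι) (T : ι → (Mat a →ₗ[ℂ] Mat b))
    (h : ∀ x ∈ s, IsCP (T x)) : IsCP (∑ x ∈ s, T x) :=
  Finset.sum_induction T IsCP (fun _ _ => IsCP.add) isCP_zero h

theorem posSemidef_maxEnt (d : ℕ) : (maxEnt d).PosSemidef :=
  Matrix.posSemidef_vecMulVec_self_star _

theorem IsCP.posSemidef_choi {a b : ℕ} {T : Mat a →ₗ[ℂ] Mat b} (hT : IsCP T) :
    (choi T).PosSemidef :=
  hT a _ (posSemidef_maxEnt a)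

theorem apply_eq_sum_choi {a b : ℕ} (T : Mat a →ₗ[ℂ] Mat b) (X : Mat a) (k l : Fin b) :
    T X k l = ∑ i, ∑ j, X i j * choi T (i, k) (j, l) := by
  simp only [apply_entry T X, choi_apply]

/-- Maps with a positive semidefinite Choi matrix have a Kraus decomposition. -/
theorem exists_kraus_of_choi {a b : ℕ} {T : Mat a →ₗ[ℂ] Mat b} (hT : (choi T).PosSemidef) :
    ∃ (N : ℕ) (K : Fin N → Matrix (Fin b) (Fin a) ℂ), T = ∑ x, conjMap (K x) := by
  obtain ⟨N, v, hv⟩ := Matrix.posSemidef_iff_eq_sum_vecMulVec.mp hT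
  -- Each vector of a rank-one decomposition of the Choi matrix, reshaped into a `b × a` matrix, is
  -- a Kraus operator.
  refine ⟨N, fun x => Matrix.of fun k i => v x (i, k), LinearMap.ext fun X => ?_⟩
  ext k l
  simp only [apply_eq_sum_choi T X, hv, LinearMap.sum_apply, Matrix.sum_apply,
    conjMap_apply_entry, Matrix.of_apply, Matrix.vecMulVec_apply, Pi.star_apply, Finset.mul_sum]
  conv_rhs => rw [Finset.sum_comm]
  refine Finset.sum_congr rfl fun i _ => ?_
  conv_rhs => rw [Finset.sum_comm]
  exact Finset.sum_congr rfl fun j _ => Finset.sum_congr rfl fun x _ => by ring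

theorem IsCP.exists_kraus {a b : ℕ} {T : Mat a →ₗ[ℂ] Mat b} (hT : IsCP T) :
    ∃ (N : ℕ) (K : Fin N → Matrix (Fin b) (Fin a) ℂ), T = ∑ x, conjMap (K x) :=
  exists_kraus_of_choi hT.posSemidef_choi

theorem isCP_of_choi {a b : ℕ} {T : Mat a →ₗ[ℂ] Mat b} (hT : (choi T).PosSemidef) : IsCP T := by
  obtain ⟨N, K, rfl⟩ := exists_kraus_of_choi hT
  exact isCP_sum _ _ fun x _ => isCP_conjMap _

theorem IsCP.comp {a b c : ℕ} {S : Mat b →ₗ[ℂ] Mat c} {T : Mat a →ₗ[ℂ] Mat b} (hS : IsCP S)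
    (hT : IsCP T) : IsCP (S ∘ₗ T) := by
  obtain ⟨N, K, rfl⟩ := hS.exists_kraus
  obtain ⟨N', K', rfl⟩ := hT.exists_kraus
  simp only [sum_linearMap_comp, linearMap_comp_sum, conjMap_comp_conjMap]
  exact isCP_sum _ _ fun x _ => isCP_sum _ _ fun y _ => isCP_conjMap _

theorem IsCP.isPositive {a b : ℕ} {T : Mat a →ₗ[ℂ] Mat b} (hT : IsCP T) : IsPositive T := by
  obtain ⟨N, K, rfl⟩ := hT.exists_kraus
  intro X hX
  rw [LinearMap.sum_apply]
  exact Matrix.posSemidef_sum _ fun x _ => conjMap_posSemidef _ hX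

/-- Conjugating a completely positive map by the transpositions gives a completely positive
map. -/
theorem IsCP.exists_comp_transposeMap {a b : ℕ} {S : Mat a →ₗ[ℂ] Mat b} (hS : IsCP S) :
    ∃ S' : Mat a →ₗ[ℂ] Mat b, IsCP S' ∧ S ∘ₗ transposeMap a = transposeMap b ∘ₗ S' := by
  obtain ⟨N, K, rfl⟩ := hS.exists_kraus
  refine ⟨∑ x, conjMap ((K x).map star), isCP_sum _ _ fun x _ => isCP_conjMap _, ?_⟩
  simp only [sum_linearMap_comp, linearMap_comp_sum, transposeMap_comp_conjMap]
  refine Finset.sum_congr rfl fun x _ => ?_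
  congr 2
  ext; simp

/-! ### Reachability by sums of conjugations. -/

/-- The maps that are finite sums of maps `X ↦ A P(B X B†) A†`. -/
def Reach {n m n' m' : Type} [Fintype n] [Fintype m] [Fintype n']
    (P : Matrix n n ℂ →ₗ[ℂ] Matrix m m ℂ) (L : Matrix n' n' ℂ →ₗ[ℂ] Matrix m' m' ℂ) : Prop :=
  ∃ (ι : Type) (_ : Fintype ι) (A : ι → Matrix m' m ℂ) (B : ι → Matrix n n' ℂ),
    L = ∑ x, conjMap (A x) ∘ₗ P ∘ₗ conjMap (B x)

namespace Reach

variable {n m n' m' n'' m'' : Type} [Fintype n] [Fintype m] [Fintype n'] [Fintype m']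
  [Fintype n''] {P : Matrix n n ℂ →ₗ[ℂ] Matrix m m ℂ} {L : Matrix n' n' ℂ →ₗ[ℂ] Matrix m' m' ℂ}
  {M : Matrix n'' n'' ℂ →ₗ[ℂ] Matrix m'' m'' ℂ}

theorem of_conj (P : Matrix n n ℂ →ₗ[ℂ] Matrix m m ℂ) (A : Matrix m'' m ℂ) (B : Matrix n n'' ℂ) :
    Reach P (conjMap A ∘ₗ P ∘ₗ conjMap B) :=
  ⟨Unit, inferInstance, fun _ => A, fun _ => B, by simp⟩

theorem zero : Reach P (0 : Matrix n'' n'' ℂ →ₗ[ℂ] Matrix m'' m'' ℂ) :=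
  ⟨Empty, inferInstance, Empty.elim, Empty.elim, by simp⟩

theorem add {M' : Matrix n'' n'' ℂ →ₗ[ℂ] Matrix m'' m'' ℂ} (h : Reach P M) (h' : Reach P M') :
    Reach P (M + M') := by
  obtain ⟨ι, _, A, B, rfl⟩ := h
  obtain ⟨κ, _, A', B', rfl⟩ := h'
  exact ⟨ι ⊕ κ, inferInstance, Sum.elim A A', Sum.elim B B', by simp⟩

theorem sum {ι : Type} (s : Finset ι) (M : ι → (Matrix n'' n'' ℂ →ₗ[ℂ] Matrix m'' m'' ℂ))
    (h : ∀ x ∈ s, Reach P (M x)) : Reach P (∑ x ∈ s, M x) :=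
  Finset.sum_induction M (Reach P) (fun _ _ => add) zero h

theorem conj (h : Reach P L) (A : Matrix m'' m' ℂ) (B : Matrix n' n'' ℂ) :
    Reach P (conjMap A ∘ₗ L ∘ₗ conjMap B) := by
  obtain ⟨ι, _, A', B', rfl⟩ := h
  simp only [sum_linearMap_comp, linearMap_comp_sum]
  refine sum _ _ fun x _ => ?_
  have : conjMap A ∘ₗ (conjMap (A' x) ∘ₗ P ∘ₗ conjMap (B' x)) ∘ₗ conjMap B =
      conjMap (A * A' x) ∘ₗ P ∘ₗ conjMap (B' x * B) := by
    simp only [← conjMap_comp_conjMap, LinearMap.comp_assoc]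
  rw [this]
  exact of_conj _ _ _

theorem trans (h : Reach P L) (h' : Reach L M) : Reach P M := by
  obtain ⟨ι, _, A, B, rfl⟩ := h'
  exact sum _ _ fun x _ => h.conj _ _

theorem smul [DecidableEq m'] [DecidableEq n'] (h : Reach P L) {r : ℝ} (hr : 0 ≤ r) :
    Reach P ((r : ℂ) • L) := by
  have := h.conj (((Real.sqrt r : ℝ) : ℂ) • (1 : Matrix m' m' ℂ)) (1 : Matrix n' n' ℂ)
  rw [conjMap_real_smul, conjMap_one, conjMap_one, Real.sq_sqrt hr] at this
  convert this using 1
  refine LinearMap.ext fun X => ?_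
  simp

/-- Transposition turns conjugation by `A` into conjugation by the entrywise conjugate of `A`, so
the outer `ϑ` passes through to meet the one in front of `P`, and the two cancel. -/
theorem of_transposeMap_comp {a b a' b' : ℕ} {P : Mat a →ₗ[ℂ] Mat b} {L : Mat a' →ₗ[ℂ] Mat b'}
    (h : Reach (transposeMap b ∘ₗ P) L) : Reach P (transposeMap b' ∘ₗ L) := by
  obtain ⟨ι, _, A, B, rfl⟩ := h
  refine ⟨ι, inferInstance, fun x => (A x).map star, B, ?_⟩
  rw [linearMap_comp_sum]
  refine Finset.sum_congr rfl fun x _ => ?_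
  rw [← LinearMap.comp_assoc, transposeMap_comp_conjMap]
  rfl

end Reach

/-! ### Decomposable maps form a mapping cone. -/

section PosSemidef

variable {n : Type} [Fintype n]

theorem isClosed_posSemidef : IsClosed {A : Matrix n n ℂ | A.PosSemidef} := by
  simp only [Matrix.posSemidef_iff_dotProduct_mulVec, Set.ofPred_and, Set.ofPred_forall]
  refine IsClosed.inter ?_ (isClosed_iInter fun x => ?_)
  · exact isClosed_eq (by fun_prop) continuous_id
  · exact isClosed_le continuous_const (by fun_prop)

theorem norm_entry_le_trace {A : Matrix n n ℂ} (hA : A.PosSemidef) (i j : n) :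
    ‖A i j‖ ≤ A.trace.re := by
  obtain ⟨N, v, rfl⟩ := Matrix.posSemidef_iff_eq_sum_vecMulVec.mp hA
  have htr : (∑ x, Matrix.vecMulVec (v x) (star (v x))).trace.re = ∑ x, ∑ k, ‖v x k‖ ^ 2 := by
    rw [Matrix.trace_sum, Complex.re_sum]
    simp only [Matrix.trace, Matrix.diag_apply, Matrix.vecMulVec_apply, Pi.star_apply,
      Complex.star_def, Complex.mul_conj, Complex.normSq_eq_norm_sq, Complex.re_sum,
      Complex.ofReal_re]
  rw [htr, Matrix.sum_apply]
  refine (norm_sum_le _ _).trans (Finset.sum_le_sum fun x _ => ?_)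
  have hi := Finset.single_le_sum (f := fun k => ‖v x k‖ ^ 2) (fun _ _ => sq_nonneg _)
    (Finset.mem_univ i)
  have hj := Finset.single_le_sum (f := fun k => ‖v x k‖ ^ 2) (fun _ _ => sq_nonneg _)
    (Finset.mem_univ j)
  simp only [Matrix.vecMulVec_apply, Pi.star_apply, norm_mul, norm_star]
  -- `|vᵢ||vⱼ|` is at most the mean of `|vᵢ|²` and `|vⱼ|²`, and each of these is at most the squared
  -- norm of `v`.
  nlinarith [sq_nonneg (‖v x i‖ - ‖v x j‖)]

theorem isCompact_posSemidef_trace_le (R : ℝ) :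
    IsCompact {A : Matrix n n ℂ | A.PosSemidef ∧ A.trace.re ≤ R} := by
  have hK : IsCompact (Set.univ.pi fun _ : n => Set.univ.pi fun _ : n =>
      Metric.closedBall (0 : ℂ) R) :=
    isCompact_univ_pi fun i => isCompact_univ_pi fun j => isCompact_closedBall 0 R
  refine IsCompact.of_isClosed_subset (s := (show Set (Matrix n n ℂ) from _)) hK ?_ ?_
  · exact isClosed_posSemidef.inter (isClosed_le
      (f := fun A : Matrix n n ℂ => A.trace.re) (by fun_prop) continuous_const)
  · rintro A ⟨hA, hR⟩ i - j -
    simpa using (norm_entry_le_trace hA i j).trans hR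

/-- If a continuous map `Γ` preserves the trace, then the sums `A + Γ B` of positive semidefinite
matrices form a closed set. -/
theorem isClosed_posSemidef_add {Γ : Matrix n n ℂ → Matrix n n ℂ} (hΓ : Continuous Γ)
    (htr : ∀ B, (Γ B).trace = B.trace) :
    IsClosed {C : Matrix n n ℂ | ∃ A B : Matrix n n ℂ,
      A.PosSemidef ∧ B.PosSemidef ∧ C = A + Γ B} := by
  refine isClosed_of_closure_subset fun C hC => ?_
  set S := {C : Matrix n n ℂ | ∃ A B : Matrix n n ℂ, A.PosSemidef ∧ B.PosSemidef ∧ C = A + Γ B}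
  -- On the open set of matrices of trace below `R`, which contains `C`, both summands of any
  -- decomposition have trace below `R`. There the set lies in the image of a compact set, and that
  -- image is closed.
  set R : ℝ := C.trace.re + 1 with hR
  set K := {A : Matrix n n ℂ | A.PosSemidef ∧ A.trace.re ≤ R}
  have hU : IsOpen {C' : Matrix n n ℂ | C'.trace.re < R} :=
    isOpen_lt (by fun_prop) continuous_const
  have hC' := hU.inter_closure ⟨show C.trace.re < R by linarith, hC⟩
  have hcomp : IsCompact ((fun q : Matrix n n ℂ × Matrix n n ℂ => q.1 + Γ q.2) '' (K ×ˢ K)) :=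
    ((isCompact_posSemidef_trace_le R).prod (isCompact_posSemidef_trace_le R)).image
      (by fun_prop)
  have hsub := closure_minimal (s := {C' : Matrix n n ℂ | C'.trace.re < R} ∩ S) (fun C' h => by
    obtain ⟨hlt, A, B, hA, hB, rfl⟩ := h
    have hA0 := (Complex.le_def.mp hA.trace_nonneg).1
    have hB0 := (Complex.le_def.mp hB.trace_nonneg).1
    simp only [Set.mem_ofPred_eq, Matrix.trace_add, htr, Complex.add_re] at hlt
    simp only [Complex.zero_re] at hA0 hB0
    exact ⟨(A, B), ⟨⟨hA, by linarith⟩, ⟨hB, by linarith⟩⟩, rfl⟩) hcomp.isClosed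
  obtain ⟨⟨A, B⟩, ⟨hA, hB⟩, rfl⟩ := hsub hC'
  exact ⟨A, B, hA.1, hB.1, rfl⟩

end PosSemidef

/-- The partial transposition of the second tensor factor. -/
def partialTranspose {a b : ℕ} (C : Matrix (Fin a × Fin b) (Fin a × Fin b) ℂ) :
    Matrix (Fin a × Fin b) (Fin a × Fin b) ℂ :=
  Matrix.of fun p q => C (p.1, q.2) (q.1, p.2)

theorem choi_transposeMap_comp {a b : ℕ} (T : Mat a →ₗ[ℂ] Mat b) :
    choi (transposeMap b ∘ₗ T) = partialTranspose (choi T) := by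
  ext ⟨i, k⟩ ⟨j, l⟩
  simp [choi_apply, partialTranspose, transposeMap_apply]

theorem choi_add {a b : ℕ} (S T : Mat a →ₗ[ℂ] Mat b) : choi (S + T) = choi S + choi T :=
  tensorMap_add_right _ _ _ _

theorem isDecomposable_iff_choi {a b : ℕ} (P : Mat a →ₗ[ℂ] Mat b) :
    IsDecomposable P ↔ ∃ A B : Matrix (Fin a × Fin b) (Fin a × Fin b) ℂ,
      A.PosSemidef ∧ B.PosSemidef ∧ choi P = A + partialTranspose B := by
  constructor
  · rintro ⟨T₁, T₂, h₁, h₂, rfl⟩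
    exact ⟨_, _, h₁.posSemidef_choi, h₂.posSemidef_choi, by
      rw [choi_add, choi_transposeMap_comp]⟩
  · rintro ⟨A, B, hA, hB, h⟩
    refine ⟨ofChoi A, ofChoi B, isCP_of_choi (by rwa [choi_ofChoi]),
      isCP_of_choi (by rwa [choi_ofChoi]), choi_injective ?_⟩
    rw [choi_add, choi_transposeMap_comp, choi_ofChoi, choi_ofChoi, h]

theorem IsPositive.transposeMap_comp {a b : ℕ} {P : Mat a →ₗ[ℂ] Mat b} (hP : IsPositive P) :
    IsPositive (transposeMap b ∘ₗ P) :=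
  fun X hX => (hP X hX).transpose

theorem IsDecomposable.isPositive {a b : ℕ} {P : Mat a →ₗ[ℂ] Mat b} (hP : IsDecomposable P) :
    IsPositive P := by
  obtain ⟨T₁, T₂, h₁, h₂, rfl⟩ := hP
  exact fun X hX => (h₁.isPositive X hX).add (h₂.isPositive.transposeMap_comp X hX)

theorem IsDecomposable.comp {a b a' b' : ℕ} {P : Mat a →ₗ[ℂ] Mat b} (hP : IsDecomposable P)
    {T : Mat a' →ₗ[ℂ] Mat a} {S : Mat b →ₗ[ℂ] Mat b'} (hT : IsCP T) (hS : IsCP S) :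
    IsDecomposable (S ∘ₗ P ∘ₗ T) := by
  obtain ⟨T₁, T₂, h₁, h₂, rfl⟩ := hP
  obtain ⟨S', hS', h⟩ := hS.exists_comp_transposeMap
  refine ⟨S ∘ₗ T₁ ∘ₗ T, S' ∘ₗ T₂ ∘ₗ T, hS.comp (h₁.comp hT), hS'.comp (h₂.comp hT), ?_⟩
  have h' : transposeMap b' ∘ₗ S' ∘ₗ T₂ ∘ₗ T = (S ∘ₗ transposeMap b) ∘ₗ T₂ ∘ₗ T := by
    rw [h, LinearMap.comp_assoc]
  rw [h', LinearMap.add_comp, LinearMap.comp_add]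
  rfl

theorem isClosed_decomposable (a b : ℕ) :
    IsClosed ((fun P : Mat a →ₗ[ℂ] Mat b => (P : Mat a → Mat b)) ''
      {P | IsDecomposable P}) := by
  have hΦ : Continuous fun g : Mat a → Mat b => (Matrix.of fun p q =>
      g (Matrix.single p.1 q.1 1) p.2 q.2 : Matrix (Fin a × Fin b) (Fin a × Fin b) ℂ) := by
    refine continuous_matrix fun p q => ?_
    exact (continuous_apply_apply p.2 q.2).comp (continuous_apply _)
  have hcl := (isClosed_posSemidef_add (n := Fin a × Fin b) (Γ := partialTranspose)
    (continuous_matrix fun p q => continuous_apply_apply _ _) (fun B => by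
      simp [Matrix.trace, partialTranspose])).preimage hΦ
  -- The topology is pointwise convergence of arbitrary functions. Reading off the values at matrix
  -- units is continuous on all functions and gives the Choi matrix on the linear ones, which form a
  -- closed set.
  convert (LinearMap.isClosed_range_coe (Mat a) (Mat b) (RingHom.id ℂ)).inter hcl using 1
  ext g
  have key : ∀ P : Mat a →ₗ[ℂ] Mat b, (Matrix.of fun p q =>
      P (Matrix.single p.1 q.1 1) p.2 q.2 : Matrix (Fin a × Fin b) (Fin a × Fin b) ℂ) =
      choi P := fun P => by
    ext ⟨i, k⟩ ⟨j, l⟩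
    simp [choi_apply]
  constructor
  · rintro ⟨P, hP, rfl⟩
    refine ⟨⟨P, rfl⟩, ?_⟩
    simp only [Set.mem_preimage, Set.mem_ofPred_eq, key]
    exact (isDecomposable_iff_choi P).mp hP
  · rintro ⟨⟨P, rfl⟩, hP⟩
    simp only [Set.mem_preimage, Set.mem_ofPred_eq, key] at hP
    exact ⟨P, (isDecomposable_iff_choi P).mpr hP, rfl⟩

theorem isMappingCone_decomposableCone : IsMappingCone decomposableCone where
  positive _ hP := IsDecomposable.isPositive hP
  closed n m := isClosed_decomposable n m
  comp_mem _ _ _ hP hT hS := IsDecomposable.comp hP hT hS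

/-! ### Tensor products and reachability. -/

section PiMatrix

variable {a b c : Type} {N : ℕ}

/-- The tensor product `K₁ ⊗ ⋯ ⊗ K_N` of matrices. -/
noncomputable def piMatrix (K : Fin N → Matrix b a ℂ) : Matrix (Fin N → b) (Fin N → a) ℂ :=
  Matrix.of fun k i => ∏ s, K s (k s) (i s)

theorem piMatrix_mul [Fintype b] [DecidableEq b] (K : Fin N → Matrix c b ℂ)
    (K' : Fin N → Matrix b a ℂ) :
    piMatrix K * piMatrix K' = piMatrix fun s => K s * K' s := by
  ext k i
  simp only [piMatrix, Matrix.mul_apply, Matrix.of_apply, Finset.prod_univ_sum,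
    Fintype.piFinset_univ, Finset.prod_mul_distrib]

theorem conjTranspose_piMatrix (K : Fin N → Matrix b a ℂ) :
    (piMatrix K).conjTranspose = piMatrix fun s => (K s).conjTranspose := by
  ext k i
  simp [piMatrix]

theorem conjMap_piMatrix [Fintype a] [DecidableEq a] (K : Fin N → Matrix b a ℂ)
    (X : Fin N → Matrix a a ℂ) :
    conjMap (piMatrix K) (piMatrix X) = piMatrix fun s => conjMap (K s) (X s) := by
  simp only [conjMap_apply, conjTranspose_piMatrix, piMatrix_mul]

theorem piTensorMap_piMatrix [Fintype a] [DecidableEq a]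
    (L : Fin N → (Matrix a a ℂ →ₗ[ℂ] Matrix b b ℂ)) (X : Fin N → Matrix a a ℂ) :
    piTensorMap L (piMatrix X) = piMatrix fun s => L s (X s) :=
  piTensorMap_prod L X

/-- Linear maps that agree on product matrices are equal. -/
theorem linearMap_ext_piMatrix [Fintype a] [DecidableEq a] {V : Type} [AddCommMonoid V]
    [Module ℂ V] {F G : Matrix (Fin N → a) (Fin N → a) ℂ →ₗ[ℂ] V}
    (h : ∀ X : Fin N → Matrix a a ℂ, F (piMatrix X) = G (piMatrix X)) : F = G := by
  refine LinearMap.ext fun X => ?_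
  rw [Matrix.matrix_eq_sum_single X]
  simp only [map_sum]
  refine Finset.sum_congr rfl fun i _ => Finset.sum_congr rfl fun j _ => ?_
  have hs : Matrix.single i j (X i j) =
      X i j • piMatrix fun s => Matrix.single (i s) (j s) (1 : ℂ) := by
    ext k l
    simp only [piMatrix, Matrix.single_apply, Matrix.smul_apply, Matrix.of_apply, smul_eq_mul,
      Finset.prod_ite_zero, Finset.prod_const_one, funext_iff, Finset.mem_univ, true_imp_iff,
      ← forall_and, mul_ite, mul_one, mul_zero]
  rw [hs, map_smul, map_smul, h]

theorem reach_piTensorMap {a' b' : Type} [Fintype a] [DecidableEq a] [Fintype b] [DecidableEq b]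
    [Fintype a'] [DecidableEq a'] {P : Fin N → (Matrix a a ℂ →ₗ[ℂ] Matrix b b ℂ)}
    {L : Fin N → (Matrix a' a' ℂ →ₗ[ℂ] Matrix b' b' ℂ)} (h : ∀ s, Reach (P s) (L s)) :
    Reach (piTensorMap P) (piTensorMap L) := by
  choose ι hι A B hL using h
  -- Expanding the product of the `N` sums gives one term for each choice of a summand in every
  -- factor.
  refine ⟨∀ s, ι s, inferInstance, fun f => piMatrix fun s => A s (f s),
    fun f => piMatrix fun s => B s (f s), linearMap_ext_piMatrix fun X => ?_⟩
  simp only [LinearMap.sum_apply, LinearMap.comp_apply, conjMap_piMatrix, piTensorMap_piMatrix]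
  ext k l
  simp only [hL, LinearMap.sum_apply, LinearMap.comp_apply, piMatrix, Matrix.sum_apply,
    Matrix.of_apply, Finset.prod_univ_sum, Fintype.piFinset_univ]

/-- The matrix of `v ↦ |j⟩ ⊗ v`. -/
noncomputable def consMatrix [DecidableEq a] (N : ℕ) (j : a) :
    Matrix (Fin (N + 1) → a) (Fin N → a) ℂ :=
  Matrix.of fun k i => if k = Fin.cons j i then 1 else 0

theorem conjMap_consMatrix [Fintype a] [DecidableEq a] (j : a) (X : Fin N → Matrix a a ℂ) :
    conjMap (consMatrix N j) (piMatrix X) =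
      piMatrix (Fin.cons (Matrix.single j j 1) X : Fin (N + 1) → Matrix a a ℂ) := by
  ext k l
  obtain ⟨k₀, k, rfl⟩ : ∃ k₀ k', k = Fin.cons k₀ k' := ⟨_, _, (Fin.cons_self_tail k).symm⟩
  obtain ⟨l₀, l, rfl⟩ : ∃ k₀ k', l = Fin.cons k₀ k' := ⟨_, _, (Fin.cons_self_tail l).symm⟩
  simp only [conjMap_apply_entry, consMatrix, piMatrix, Matrix.of_apply, Fin.prod_univ_succ,
    Fin.cons_zero, Fin.cons_succ, Fin.cons_inj, Matrix.single_apply]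
  by_cases hk : k₀ = j <;> by_cases hl : l₀ = j <;> simp [hk, hl, eq_comm (a := j)]

theorem conjMap_conjTranspose_consMatrix [Fintype a] [DecidableEq a] (j : a) (Y : Matrix a a ℂ)
    (X : Fin N → Matrix a a ℂ) :
    conjMap (consMatrix N j).conjTranspose
      (piMatrix (Fin.cons Y X : Fin (N + 1) → Matrix a a ℂ)) = Y j j • piMatrix X := by
  ext k l
  simp only [conjMap_apply_entry, consMatrix, piMatrix, Matrix.of_apply,
    Matrix.conjTranspose_apply, Matrix.smul_apply]
  simp [Fin.prod_univ_succ]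

/-- Feeding `|j⟩⟨j|` into the first factor and compressing its output to a basis vector yields a
diagonal entry of `P(|j⟩⟨j|)`. Summed over both indices, these entries give `Tr P(1)`. -/
theorem reach_piTensorMap_succ [Fintype a] [DecidableEq a] [Fintype b] [DecidableEq b]
    (P : Matrix a a ℂ →ₗ[ℂ] Matrix b b ℂ) :
    Reach (piTensorMap fun _ : Fin (N + 1) => P)
      ((P 1).trace • piTensorMap fun _ : Fin N => P) := by
  refine ⟨a × b, inferInstance, fun x => (consMatrix N x.2).conjTranspose,
    fun x => consMatrix N x.1, linearMap_ext_piMatrix fun X => ?_⟩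
  have hc : ∀ j, (fun s => P ((Fin.cons (Matrix.single j j 1) X : Fin (N + 1) → _) s)) =
      (Fin.cons (P (Matrix.single j j 1)) fun s => P (X s) : Fin (N + 1) → Matrix b b ℂ) := by
    intro j
    funext s
    refine Fin.cases ?_ (fun s => ?_) s <;> simp
  simp only [LinearMap.sum_apply, LinearMap.comp_apply, LinearMap.smul_apply, conjMap_consMatrix,
    piTensorMap_piMatrix, hc, conjMap_conjTranspose_consMatrix, ← Finset.sum_smul]
  congr 1
  have h1 : (1 : Matrix a a ℂ) = ∑ j, Matrix.single j j 1 := by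
    ext i j
    simp [Matrix.sum_apply, Matrix.single_apply, Matrix.one_apply, ite_and]
  rw [h1, Fintype.sum_prod_type]
  simp only [map_sum, Matrix.trace_sum]
  rfl

end PiMatrix

/-- Reindexing a square matrix is conjugation by a permutation matrix. -/
theorem reindexLinearEquiv_eq_conjMap {m n : Type} [Fintype m] [DecidableEq m] [Fintype n]
    [DecidableEq n] (e : m ≃ n) :
    (Matrix.reindexLinearEquiv ℂ ℂ e e).toLinearMap =
      conjMap ((1 : Matrix m m ℂ).submatrix e.symm id) := by
  refine LinearMap.ext fun X => ?_
  rw [conjMap_one_submatrix]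
  rfl

section TensorFamily

variable {a b a' b' N N' : ℕ}

theorem reach_tensorFamily_piTensorMap (L : Fin N → (Mat a →ₗ[ℂ] Mat b)) :
    Reach (tensorFamily L) (piTensorMap L) := by
  have h : piTensorMap L = (Matrix.reindexLinearEquiv ℂ ℂ
      (finFunctionFinEquiv (m := b) (n := N)).symm (finFunctionFinEquiv (m := b) (n := N)).symm
      ).toLinearMap ∘ₗ tensorFamily L ∘ₗ (Matrix.reindexLinearEquiv ℂ ℂ
      (finFunctionFinEquiv (m := a) (n := N))
      (finFunctionFinEquiv (m := a) (n := N))).toLinearMap := by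
    refine LinearMap.ext fun X => ?_
    simp [tensorFamily]
  rw [h, reindexLinearEquiv_eq_conjMap, reindexLinearEquiv_eq_conjMap]
  exact Reach.of_conj _ _ _

theorem reach_piTensorMap_tensorFamily (L : Fin N → (Mat a →ₗ[ℂ] Mat b)) :
    Reach (piTensorMap L) (tensorFamily L) := by
  rw [tensorFamily, Matrix.symm_reindexLinearEquiv, reindexLinearEquiv_eq_conjMap,
    reindexLinearEquiv_eq_conjMap]
  exact Reach.of_conj _ _ _

theorem reach_tensorFamily {P : Fin N → (Mat a →ₗ[ℂ] Mat b)}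
    {L : Fin N → (Mat a' →ₗ[ℂ] Mat b')} (h : ∀ s, Reach (P s) (L s)) :
    Reach (tensorFamily P) (tensorFamily L) :=
  ((reach_tensorFamily_piTensorMap P).trans (reach_piTensorMap h)).trans
    (reach_piTensorMap_tensorFamily L)

theorem reach_tensorPower_succ {P : Mat a →ₗ[ℂ] Mat b} {t : ℝ} (ht : 0 < t)
    (hP : (P 1).trace = t) : Reach (tensorPower (N + 1) P) (tensorPower N P) := by
  have h := ((reach_tensorFamily_piTensorMap _).trans
    (reach_piTensorMap_succ (N := N) P)).smul (inv_nonneg.mpr ht.le)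
  rw [hP, smul_smul, ← Complex.ofReal_mul, inv_mul_cancel₀ ht.ne', Complex.ofReal_one,
    one_smul] at h
  exact h.trans (reach_piTensorMap_tensorFamily _)

theorem reach_tensorPower_le {P : Mat a →ₗ[ℂ] Mat b} {t : ℝ} (ht : 0 < t)
    (hP : (P 1).trace = t) (h : N' ≤ N) : Reach (tensorPower N P) (tensorPower N' P) := by
  induction h with
  | refl =>
    have := Reach.of_conj (tensorPower N' P) (1 : Mat (b ^ N')) (1 : Mat (a ^ N'))
    rwa [conjMap_one, conjMap_one] at this
  | step _ ih => exact (reach_tensorPower_succ ht hP).trans ih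

end TensorFamily

theorem IsMappingCone.mem_of_reach {C : ∀ n m : ℕ, ConvexCone ℝ (Mat n →ₗ[ℂ] Mat m)}
    (hC : IsMappingCone C) {a b a' b' : ℕ} {P : Mat a →ₗ[ℂ] Mat b} {L : Mat a' →ₗ[ℂ] Mat b'}
    (hP : P ∈ C a b) (h : Reach P L) : L ∈ C a' b' := by
  obtain ⟨ι, _, A, B, rfl⟩ := h
  refine Finset.sum_induction _ (· ∈ C a' b') (fun _ _ hx hy => (C a' b').add_mem hx hy) ?_
    fun x _ => hC.comp_mem P _ _ hP (isCP_conjMap _) (isCP_conjMap _)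
  -- The empty sum requires `0` in the cone. A `ConvexCone` need not contain it, but composing `P`
  -- with the completely positive map `0` produces it.
  simpa using hC.comp_mem P (0 : Mat a' →ₗ[ℂ] Mat a) (0 : Mat b →ₗ[ℂ] Mat b') hP
    isCP_zero isCP_zero

/-! ### Invariant functionals and the twirl over monomial unitaries. -/

section Functionals

variable {d : ℕ}

/-- The trace of a linear map `L : M_d → M_d`. -/
noncomputable def superTrace : (Mat d →ₗ[ℂ] Mat d) →ₗ[ℂ] ℂ where
  toFun L := ∑ i, ∑ j, L (Matrix.single i j 1) i j
  map_add' L L' := by simp [Finset.sum_add_distrib]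
  map_smul' r L := by simp [Finset.mul_sum]

/-- The trace of `L(1)`. -/
noncomputable def traceOne : (Mat d →ₗ[ℂ] Mat d) →ₗ[ℂ] ℂ where
  toFun L := ∑ i, ∑ k, L (Matrix.single i i 1) k k
  map_add' L L' := by simp [Finset.sum_add_distrib]
  map_smul' r L := by simp [Finset.mul_sum]

/-- The sum of the diagonal matrix elements `⟨i| L(|i⟩⟨i|) |i⟩`. -/
noncomputable def diagTrace : (Mat d →ₗ[ℂ] Mat d) →ₗ[ℂ] ℂ where
  toFun L := ∑ i, L (Matrix.single i i 1) i i
  map_add' L L' := by simp [Finset.sum_add_distrib]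
  map_smul' r L := by simp [Finset.mul_sum]

theorem superTrace_apply (L : Mat d →ₗ[ℂ] Mat d) :
    superTrace L = ∑ i, ∑ j, L (Matrix.single i j 1) i j := rfl

theorem traceOne_apply (L : Mat d →ₗ[ℂ] Mat d) :
    traceOne L = ∑ i, ∑ k, L (Matrix.single i i 1) k k := rfl

theorem diagTrace_apply (L : Mat d →ₗ[ℂ] Mat d) :
    diagTrace L = ∑ i, L (Matrix.single i i 1) i i := rfl

theorem one_eq_sum_single : (1 : Mat d) = ∑ i, Matrix.single i i 1 := by
  ext i j
  simp [Matrix.sum_apply, Matrix.single_apply, Matrix.one_apply, ite_and]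

theorem traceOne_eq (L : Mat d →ₗ[ℂ] Mat d) : traceOne L = (L 1).trace := by
  rw [one_eq_sum_single, map_sum, Matrix.trace_sum]
  rfl

/-- The map `X ↦ α X + β Tr(X) 1 + γ diag(X)`. -/
noncomputable def threeForm (d : ℕ) (α β γ : ℂ) : Mat d →ₗ[ℂ] Mat d where
  toFun X := α • X + (β * X.trace) • 1 + γ • Matrix.diagonal X.diag
  map_add' X Y := by
    ext i j
    by_cases h : i = j
    · simp [h]; ring
    · simp [h]; try ring
  map_smul' r X := by
    ext i j
    by_cases h : i = j
    · simp [h]; ring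
    · simp [h]; try ring

theorem threeForm_apply_entry (α β γ : ℂ) (X : Mat d) (k l : Fin d) :
    threeForm d α β γ X k l =
      α * X k l + if k = l then β * X.trace + γ * X k k else 0 := by
  by_cases h : k = l <;> simp [threeForm, h]
  ring

theorem threeForm_single (α β γ : ℂ) (i j k l : Fin d) :
    threeForm d α β γ (Matrix.single i j 1) k l =
      (if i = k ∧ j = l then α else 0) + (if i = j ∧ k = l then β else 0) +
        if i = j ∧ k = l ∧ i = k then γ else 0 := by
  rw [threeForm_apply_entry]
  by_cases hij : i = j
  · subst hij
    by_cases hkl : k = l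
    · subst hkl
      by_cases hik : i = k <;> simp [hik]
      ring
    · simp [Matrix.single_apply, hkl]
  · by_cases hkl : k = l
    · subst hkl
      have : ¬ (i = k ∧ j = k) := fun h => hij (h.1.trans h.2.symm)
      simp [hij, this]
    · simp [Matrix.single_apply, hij, hkl]

theorem superTrace_threeForm (α β γ : ℂ) :
    superTrace (threeForm d α β γ) = α * d ^ 2 + β * d + γ * d := by
  simp only [superTrace_apply, threeForm_single, Finset.sum_add_distrib]
  simp
  ring

theorem traceOne_threeForm (α β γ : ℂ) :
    traceOne (threeForm d α β γ) = α * d + β * d ^ 2 + γ * d := by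
  simp only [traceOne_apply, threeForm_single, Finset.sum_add_distrib]
  simp
  ring

theorem diagTrace_threeForm (α β γ : ℂ) :
    diagTrace (threeForm d α β γ) = α * d + β * d + γ * d := by
  simp only [diagTrace_apply, threeForm_single, Finset.sum_add_distrib]
  simp
  ring

end Functionals

section PhaseAverage

noncomputable instance fintypeFourthRoots : Fintype (rootsOfUnity 4 ℂ) := Fintype.ofFinite _

variable {d : ℕ}

theorem conj_diagonal_single (z : Fin d → ℂ) (L : Mat d →ₗ[ℂ] Mat d) (i j k l : Fin d) :
    (conjMap (Matrix.diagonal z) ∘ₗ L ∘ₗ conjMap (Matrix.diagonal (star z)))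
      (Matrix.single i j 1) k l =
    (z k * z j * star (z i) * star (z l)) * L (Matrix.single i j 1) k l := by
  have h : conjMap (Matrix.diagonal (star z)) (Matrix.single i j 1) =
      (star (z i) * z j) • Matrix.single i j (1 : ℂ) := by
    ext k l
    simp only [conjMap_apply, Matrix.diagonal_conjTranspose, star_star, Matrix.mul_diagonal,
      Matrix.diagonal_mul, Matrix.single_apply, Matrix.smul_apply, Pi.star_apply, smul_eq_mul]
    by_cases h : i = k ∧ j = l
    · simp [h]
    · simp [h]
  rw [LinearMap.comp_apply, LinearMap.comp_apply, h, map_smul, map_smul]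
  simp [conjMap_apply, Matrix.diagonal_conjTranspose]
  ring

/-- A vector of fourth roots of unity. -/
noncomputable def phaseVec (z : Fin d → rootsOfUnity 4 ℂ) : Fin d → ℂ := fun i => ((z i : ℂˣ) : ℂ)

theorem phaseVec_mul_star (z : Fin d → rootsOfUnity 4 ℂ) (i : Fin d) :
    phaseVec z i * star (phaseVec z i) = 1 := by
  have h : ‖phaseVec z i‖ = 1 := Complex.norm_eq_one_of_mem_rootsOfUnity (z i).2
  rw [Complex.star_def, Complex.mul_conj, Complex.normSq_eq_norm_sq, h]
  simp

/-- `z_k z_j z̄_i z̄_l`. -/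
noncomputable def phaseChar (i j k l : Fin d) (z : Fin d → rootsOfUnity 4 ℂ) : ℂ :=
  phaseVec z k * phaseVec z j * star (phaseVec z i) * star (phaseVec z l)

theorem phaseChar_mul (i j k l : Fin d) (w z : Fin d → rootsOfUnity 4 ℂ) :
    phaseChar i j k l (w * z) = phaseChar i j k l w * phaseChar i j k l z := by
  simp [phaseChar, phaseVec]
  ring

/-- The fourth root of unity `i`. -/
noncomputable def fourthRoot : rootsOfUnity 4 ℂ :=
  rootsOfUnity.mkOfPowEq Complex.I Complex.I_pow_four

/-- Some index does not cancel in `z_k z_j z̄_i z̄_l`, and setting only its phase to the imaginary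
unit detects this. Signs would not suffice: for `k = j`, `i = l`, `i ≠ j` the character is `z_k²
z̄_i²`, whose value `-1` requires a phase of order four. -/
theorem exists_phaseChar_ne_one {i j k l : Fin d} (h : ¬ ((i = j ∧ k = l) ∨ (i = k ∧ j = l))) :
    ∃ w, phaseChar i j k l w ≠ 1 := by
  have hv : ∀ x y : Fin d, phaseVec (Function.update 1 x fourthRoot) y =
      if y = x then Complex.I else 1 := by
    intro x y
    by_cases hy : y = x
    · subst hy; simp [phaseVec, fourthRoot]
    · simp [phaseVec, hy]
  have hI : Complex.I ≠ 1 := fun h => by simpa using congrArg Complex.re h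
  have hI' : -Complex.I ≠ 1 := fun h => by simpa using congrArg Complex.re h
  have hm : (-1 : ℂ) ≠ 1 := by norm_num
  by_cases hki : k = i
  · have hjl : j ≠ l := fun e => h (Or.inr ⟨hki.symm, e⟩)
    refine ⟨Function.update 1 j fourthRoot, ?_⟩
    subst hki
    by_cases hkj : k = j <;>
      simp [phaseChar, hv, hkj, hjl.symm, hI]
  · by_cases hkl : k = l
    · have hij : i ≠ j := fun e => h (Or.inl ⟨e, hkl⟩)
      refine ⟨Function.update 1 j fourthRoot, ?_⟩
      subst hkl
      by_cases hkj : k = j <;>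
        simp [phaseChar, hv, hkj, hij, hI]
    · refine ⟨Function.update 1 k fourthRoot, ?_⟩
      by_cases hjk : j = k <;>
        simp [phaseChar, hv, hjk, Ne.symm hki, Ne.symm hkl, hI, hm]

theorem sum_phaseChar (i j k l : Fin d) :
    ∑ z, phaseChar i j k l z =
      if (i = j ∧ k = l) ∨ (i = k ∧ j = l) then
        (Fintype.card (Fin d → rootsOfUnity 4 ℂ) : ℂ) else 0 := by
  split_ifs with h
  · have : ∀ z, phaseChar i j k l z = 1 := by
      intro z
      have hz := phaseVec_mul_star z
      rcases h with ⟨rfl, rfl⟩ | ⟨rfl, rfl⟩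
      · calc _ = (phaseVec z i * star (phaseVec z i)) * (phaseVec z k * star (phaseVec z k)) := by
              simp only [phaseChar]; ring
          _ = 1 := by rw [hz, hz, one_mul]
      · calc _ = (phaseVec z i * star (phaseVec z i)) * (phaseVec z j * star (phaseVec z j)) := by
              simp only [phaseChar]; ring
          _ = 1 := by rw [hz, hz, one_mul]
    simp [this]
  · obtain ⟨w, hw⟩ := exists_phaseChar_ne_one h
    have h1 : ∑ z, phaseChar i j k l z = phaseChar i j k l w * ∑ z, phaseChar i j k l z := by
      conv_lhs => rw [← Equiv.sum_comp (Equiv.mulLeft w)]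
      simp only [Equiv.coe_mulLeft, phaseChar_mul, Finset.mul_sum]
    have h2 : (1 - phaseChar i j k l w) * ∑ z, phaseChar i j k l z = 0 := by
      linear_combination h1
    exact (mul_eq_zero.mp h2).resolve_left (sub_ne_zero.mpr hw.symm)

/-- The average over diagonal unitaries, up to normalization. -/
noncomputable def phaseAverage (L : Mat d →ₗ[ℂ] Mat d) : Mat d →ₗ[ℂ] Mat d :=
  ∑ z : Fin d → rootsOfUnity 4 ℂ, conjMap (Matrix.diagonal (phaseVec z)) ∘ₗ L ∘ₗ
    conjMap (Matrix.diagonal (star (phaseVec z)))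

theorem reach_phaseAverage (L : Mat d →ₗ[ℂ] Mat d) : Reach L (phaseAverage L) :=
  ⟨_, inferInstance, _, _, rfl⟩

theorem phaseAverage_single (L : Mat d →ₗ[ℂ] Mat d) (i j k l : Fin d) :
    phaseAverage L (Matrix.single i j 1) k l =
      if (i = j ∧ k = l) ∨ (i = k ∧ j = l) then
        Fintype.card (Fin d → rootsOfUnity 4 ℂ) * L (Matrix.single i j 1) k l else 0 := by
  simp only [phaseAverage, LinearMap.sum_apply, Matrix.sum_apply, conj_diagonal_single]
  rw [← Finset.sum_mul]
  simp only [← phaseChar.eq_1, sum_phaseChar, ite_mul, zero_mul]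

end PhaseAverage

section PermAverage

variable {d : ℕ}

theorem conj_perm_single (σ : Equiv.Perm (Fin d)) (L : Mat d →ₗ[ℂ] Mat d) (i j k l : Fin d) :
    (conjMap ((1 : Mat d).submatrix σ id) ∘ₗ L ∘ₗ conjMap ((1 : Mat d).submatrix σ.symm id))
      (Matrix.single i j 1) k l =
    L (Matrix.single (σ i) (σ j) 1) (σ k) (σ l) := by
  have h : conjMap ((1 : Mat d).submatrix σ.symm id) (Matrix.single i j 1) =
      Matrix.single (σ i) (σ j) (1 : ℂ) := by
    ext k l
    rw [conjMap_one_submatrix]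
    simp [Matrix.single_apply, Equiv.eq_symm_apply]
  rw [LinearMap.comp_apply, LinearMap.comp_apply, h, conjMap_one_submatrix]
  rfl

/-- The average over permutation matrices, up to normalization. -/
noncomputable def permAverage (L : Mat d →ₗ[ℂ] Mat d) : Mat d →ₗ[ℂ] Mat d :=
  ∑ σ : Equiv.Perm (Fin d), conjMap ((1 : Mat d).submatrix σ id) ∘ₗ L ∘ₗ
    conjMap ((1 : Mat d).submatrix σ.symm id)

theorem reach_permAverage (L : Mat d →ₗ[ℂ] Mat d) : Reach L (permAverage L) :=
  ⟨_, inferInstance, _, _, rfl⟩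

theorem permAverage_single (L : Mat d →ₗ[ℂ] Mat d) (i j k l : Fin d) :
    permAverage L (Matrix.single i j 1) k l =
      ∑ σ : Equiv.Perm (Fin d), L (Matrix.single (σ i) (σ j) 1) (σ k) (σ l) := by
  simp only [permAverage, LinearMap.sum_apply, Matrix.sum_apply, conj_perm_single]

theorem permAverage_single_perm (L : Mat d →ₗ[ℂ] Mat d) (τ : Equiv.Perm (Fin d))
    (i j k l : Fin d) :
    permAverage L (Matrix.single (τ i) (τ j) 1) (τ k) (τ l) =
      permAverage L (Matrix.single i j 1) k l := by
  simp only [permAverage_single]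
  exact Equiv.sum_comp (Equiv.mulRight τ) fun σ : Equiv.Perm (Fin d) =>
    L (Matrix.single (σ i) (σ j) 1) (σ k) (σ l)

/-- Two-transitivity of the symmetric group makes twirled entries depend only on which indices
coincide. -/
theorem exists_perm_pair {i₀ i₁ i j : Fin d} (h₀ : i₀ ≠ i₁) (h : i ≠ j) :
    ∃ τ : Equiv.Perm (Fin d), τ i₀ = i ∧ τ i₁ = j := by
  refine ⟨Equiv.swap (Equiv.swap i₀ i i₁) j * Equiv.swap i₀ i, ?_, ?_⟩
  · rw [Equiv.Perm.mul_apply, Equiv.swap_apply_left]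
    refine Equiv.swap_apply_of_ne_of_ne (fun e => h₀ ?_) h
    have := congrArg (Equiv.swap i₀ i) e
    simpa using this
  · simp

end PermAverage

section Twirl

variable {d : ℕ}

/-- The average over the group of monomial unitaries, up to normalization. -/
noncomputable def monomialTwirl (L : Mat d →ₗ[ℂ] Mat d) : Mat d →ₗ[ℂ] Mat d :=
  permAverage (phaseAverage L)

theorem reach_monomialTwirl (L : Mat d →ₗ[ℂ] Mat d) : Reach L (monomialTwirl L) :=
  (reach_phaseAverage L).trans (reach_permAverage _)

/-- The normalization of `monomialTwirl`. -/
noncomputable def twirlCard (d : ℕ) : ℕ :=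
  Fintype.card (Equiv.Perm (Fin d)) * Fintype.card (Fin d → rootsOfUnity 4 ℂ)

theorem twirlCard_pos (d : ℕ) : 0 < twirlCard d :=
  Nat.mul_pos Fintype.card_pos Fintype.card_pos

theorem superTrace_monomialTwirl (L : Mat d →ₗ[ℂ] Mat d) :
    superTrace (monomialTwirl L) = twirlCard d * superTrace L := by
  simp only [superTrace_apply, monomialTwirl, permAverage_single, phaseAverage_single, and_self,
    or_true, if_true]
  calc _ = ∑ σ : Equiv.Perm (Fin d), ∑ i, ∑ j,
        (Fintype.card (Fin d → rootsOfUnity 4 ℂ) : ℂ) *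
          L (Matrix.single (σ i) (σ j) 1) (σ i) (σ j) := by
        simp only [Finset.sum_comm (s := (Finset.univ : Finset (Equiv.Perm (Fin d))))]
    _ = ∑ σ : Equiv.Perm (Fin d), ∑ i, ∑ j,
        (Fintype.card (Fin d → rootsOfUnity 4 ℂ) : ℂ) * L (Matrix.single i j 1) i j := by
        refine Finset.sum_congr rfl fun σ _ => ?_
        conv_rhs => rw [← Equiv.sum_comp σ]
        exact Finset.sum_congr rfl fun i _ => (Equiv.sum_comp σ fun j =>
          (Fintype.card (Fin d → rootsOfUnity 4 ℂ) : ℂ) * L (Matrix.single (σ i) j 1) (σ i) j)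
    _ = _ := by
        simp only [← Finset.mul_sum, Finset.sum_const, Finset.card_univ, nsmul_eq_mul, twirlCard,
          Nat.cast_mul]
        ring

theorem traceOne_monomialTwirl (L : Mat d →ₗ[ℂ] Mat d) :
    traceOne (monomialTwirl L) = twirlCard d * traceOne L := by
  simp only [traceOne_apply, monomialTwirl, permAverage_single, phaseAverage_single, and_self,
    true_or, if_true]
  calc _ = ∑ σ : Equiv.Perm (Fin d), ∑ i, ∑ j,
        (Fintype.card (Fin d → rootsOfUnity 4 ℂ) : ℂ) *
          L (Matrix.single (σ i) (σ i) 1) (σ j) (σ j) := by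
        simp only [Finset.sum_comm (s := (Finset.univ : Finset (Equiv.Perm (Fin d))))]
    _ = ∑ σ : Equiv.Perm (Fin d), ∑ i, ∑ j,
        (Fintype.card (Fin d → rootsOfUnity 4 ℂ) : ℂ) * L (Matrix.single i i 1) j j := by
        refine Finset.sum_congr rfl fun σ _ => ?_
        conv_rhs => rw [← Equiv.sum_comp σ]
        exact Finset.sum_congr rfl fun i _ => (Equiv.sum_comp σ fun j =>
          (Fintype.card (Fin d → rootsOfUnity 4 ℂ) : ℂ) * L (Matrix.single (σ i) (σ i) 1) j j)
    _ = _ := by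
        simp only [← Finset.mul_sum, Finset.sum_const, Finset.card_univ, nsmul_eq_mul, twirlCard,
          Nat.cast_mul]
        ring

theorem diagTrace_monomialTwirl (L : Mat d →ₗ[ℂ] Mat d) :
    diagTrace (monomialTwirl L) = twirlCard d * diagTrace L := by
  simp only [diagTrace_apply, monomialTwirl, permAverage_single, phaseAverage_single, and_self,
    true_or, if_true]
  rw [Finset.sum_comm]
  calc _ = ∑ σ : Equiv.Perm (Fin d), ∑ i,
        (Fintype.card (Fin d → rootsOfUnity 4 ℂ) : ℂ) * L (Matrix.single i i 1) i i :=
        Finset.sum_congr rfl fun σ _ => (Equiv.sum_comp σ fun i =>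
          (Fintype.card (Fin d → rootsOfUnity 4 ℂ) : ℂ) * L (Matrix.single i i 1) i i)
    _ = _ := by
        simp only [← Finset.mul_sum, Finset.sum_const, Finset.card_univ, nsmul_eq_mul, twirlCard,
          Nat.cast_mul]
        ring

/-- The phases leave only the entries with `i = j`, `k = l` or with `i = k`, `j = l`. Permutations
divide these into three orbits, and the map is constant on each. -/
theorem exists_monomialTwirl_eq_threeForm (hd : 2 ≤ d) (L : Mat d →ₗ[ℂ] Mat d) :
    ∃ α β γ : ℂ, monomialTwirl L = threeForm d α β γ := by
  set M := monomialTwirl L with hM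
  have hsupp : ∀ i j k l : Fin d, ¬ ((i = j ∧ k = l) ∨ (i = k ∧ j = l)) →
      M (Matrix.single i j 1) k l = 0 := by
    intro i j k l h
    simp only [hM, monomialTwirl, permAverage_single, phaseAverage_single,
      EmbeddingLike.apply_eq_iff_eq, if_neg h, Finset.sum_const_zero]
  let i₀ : Fin d := ⟨0, by omega⟩
  let i₁ : Fin d := ⟨1, by omega⟩
  have h01 : i₀ ≠ i₁ := by simp [i₀, i₁, Fin.ext_iff]
  set α := M (Matrix.single i₀ i₁ 1) i₀ i₁ with hα
  set β := M (Matrix.single i₀ i₀ 1) i₁ i₁ with hβ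
  set δ := M (Matrix.single i₀ i₀ 1) i₀ i₀ with hδ
  have h1 : ∀ i j, i ≠ j → M (Matrix.single i j 1) i j = α := by
    intro i j h
    obtain ⟨τ, rfl, rfl⟩ := exists_perm_pair h01 h
    exact permAverage_single_perm _ τ _ _ _ _
  have h2 : ∀ i k, i ≠ k → M (Matrix.single i i 1) k k = β := by
    intro i j h
    obtain ⟨τ, rfl, rfl⟩ := exists_perm_pair h01 h
    exact permAverage_single_perm _ τ _ _ _ _
  have h3 : ∀ i, M (Matrix.single i i 1) i i = δ := by
    intro i
    have := permAverage_single_perm (phaseAverage L) (Equiv.swap i₀ i) i₀ i₀ i₀ i₀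
    rwa [Equiv.swap_apply_left] at this
  -- All three terms of `threeForm` contribute when the four indices coincide, so `γ` is what
  -- remains of `δ`.
  refine ⟨α, β, δ - α - β, choi_injective ?_⟩
  ext ⟨i, k⟩ ⟨j, l⟩
  rw [choi_apply, choi_apply, threeForm_single]
  by_cases hij : i = j
  · subst hij
    by_cases hkl : k = l
    · subst hkl
      by_cases hik : i = k
      · subst hik
        simp [h3]
      · simp [h2 i k hik, hik]
    · rw [hsupp _ _ _ _ (by rintro (⟨-, h⟩ | ⟨h, h'⟩); exacts [hkl h, hkl (h.symm.trans h')])]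
      have : ¬ (i = k ∧ i = l) := fun h => hkl (h.1.symm.trans h.2)
      simp [hkl, this]
  · by_cases h : i = k ∧ j = l
    · obtain ⟨rfl, rfl⟩ := h
      simp [h1 i j hij, hij]
    · rw [hsupp _ _ _ _ (by rintro (⟨h', -⟩ | h'); exacts [hij h', h h'])]
      simp [hij, h]

end Twirl

/-! ### Fourier conjugation and removal of the diagonal term. -/

section Fourier

variable {d : ℕ}

/-- The unnormalized discrete Fourier matrix. -/
noncomputable def fourier (d : ℕ) : Mat d :=
  Matrix.of fun i j => Complex.exp (2 * Real.pi * Complex.I / d) ^ (i.val * j.val)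

theorem fourier_mul_star (i j : Fin d) : fourier d i j * star (fourier d i j) = 1 := by
  have hd : d ≠ 0 := (Fin.pos i).ne'
  have h : ‖fourier d i j‖ = 1 := by
    rw [fourier, Matrix.of_apply, norm_pow,
      (Complex.isPrimitiveRoot_exp d hd).norm'_eq_one hd, one_pow]
  rw [Complex.star_def, Complex.mul_conj, Complex.normSq_eq_norm_sq, h]
  simp

theorem fourier_mul_conjTranspose (d : ℕ) :
    fourier d * (fourier d).conjTranspose = (d : ℂ) • (1 : Mat d) := by
  ext i j
  have hd : d ≠ 0 := (Fin.pos i).ne'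
  have hζ := Complex.isPrimitiveRoot_exp d hd
  set ζ := Complex.exp (2 * Real.pi * Complex.I / d) with hζd
  rw [Matrix.mul_apply, Matrix.smul_apply]
  by_cases hij : i = j
  · subst hij
    simp only [Matrix.conjTranspose_apply, fourier_mul_star]
    simp
  · have hs : star ζ = ζ⁻¹ := by
      rw [Complex.star_def, Complex.inv_def, Complex.normSq_eq_norm_sq, hζ.norm'_eq_one hd]
      simp
    have h0 : ζ ≠ 0 := hζ.ne_zero hd
    set w := ζ ^ i.val * ζ⁻¹ ^ j.val with hw
    have hw1 : w ≠ 1 := by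
      intro h
      rw [hw, inv_pow, mul_inv_eq_one₀ (pow_ne_zero _ h0)] at h
      exact hij (Fin.ext (hζ.pow_inj i.2 j.2 h))
    have hwd : w ^ d = 1 := by
      have hk : ∀ k : ℕ, (ζ ^ k) ^ d = 1 := fun k => by
        rw [← pow_mul, mul_comm, pow_mul, hζ.pow_eq_one, one_pow]
      rw [hw, mul_pow, inv_pow, inv_pow, hk, hk, inv_one, one_mul]
    have hsum : ∑ m : Fin d, fourier d i m * (fourier d).conjTranspose m j =
        ∑ m ∈ Finset.range d, w ^ m := by
      rw [← Fin.sum_univ_eq_sum_range (fun m => w ^ m) d]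
      refine Finset.sum_congr rfl fun m _ => ?_
      simp only [fourier, Matrix.conjTranspose_apply, Matrix.of_apply, ← hζd, star_pow, hs, hw,
        mul_pow, ← pow_mul]
    have := geom_sum_mul w d
    rw [hwd, sub_self] at this
    rw [hsum, (mul_eq_zero.mp this).resolve_right (sub_ne_zero.mpr hw1)]
    simp [hij]

/-- The diagonal part of a matrix in the Fourier basis, up to normalization. -/
noncomputable def fourierDiag (d : ℕ) : Mat d →ₗ[ℂ] Mat d :=
  conjMap (fourier d) ∘ₗ threeForm d 0 0 1 ∘ₗ conjMap (fourier d).conjTranspose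

theorem fourierDiag_single (i j k l : Fin d) :
    fourierDiag d (Matrix.single i j 1) k l =
      ∑ m, fourier d k m * (star (fourier d i m) * fourier d j m) * star (fourier d l m) := by
  rw [fourierDiag, LinearMap.comp_apply, LinearMap.comp_apply, conjMap_apply_entry]
  refine Finset.sum_congr rfl fun m _ => ?_
  have : ∀ m m', threeForm d 0 0 1 (conjMap (fourier d).conjTranspose (Matrix.single i j 1)) m m' =
      if m = m' then star (fourier d i m) * fourier d j m else 0 := by
    intro m m'
    rw [threeForm_apply_entry]
    simp [conjMap_apply_entry, Matrix.single_apply, ite_and]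
  simp [this]

theorem superTrace_fourierDiag : superTrace (fourierDiag d) = d ^ 3 := by
  have : ∀ i j m : Fin d, fourier d i m * (star (fourier d i m) * fourier d j m) *
      star (fourier d j m) = 1 := fun i j m => by
    rw [← mul_assoc, fourier_mul_star, one_mul, fourier_mul_star]
  simp only [superTrace_apply, fourierDiag_single, this]
  simp
  ring

theorem traceOne_fourierDiag : traceOne (fourierDiag d) = d ^ 3 := by
  have : ∀ i k m : Fin d, fourier d k m * (star (fourier d i m) * fourier d i m) *
      star (fourier d k m) = 1 := fun i k m => by
    rw [mul_comm (star (fourier d i m)), fourier_mul_star, mul_one, fourier_mul_star]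
  simp only [traceOne_apply, fourierDiag_single, this]
  simp
  ring

theorem diagTrace_fourierDiag : diagTrace (fourierDiag d) = d ^ 2 := by
  have : ∀ i m : Fin d, fourier d i m * (star (fourier d i m) * fourier d i m) *
      star (fourier d i m) = 1 := fun i m => by
    rw [mul_comm (star (fourier d i m)), fourier_mul_star, mul_one, fourier_mul_star]
  simp only [diagTrace_apply, fourierDiag_single, this]
  simp
  ring

/-- The isotropic part commutes with conjugation by unitaries. The factor `d ^ 2` appears because
`fourier d` is `√d` times a unitary. Only the diagonal part moves to the Fourier basis. -/
theorem conj_fourier_threeForm (α β γ : ℂ) :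
    conjMap (fourier d) ∘ₗ threeForm d α β γ ∘ₗ conjMap (fourier d).conjTranspose =
      threeForm d (d ^ 2 * α) (d ^ 2 * β) 0 + γ • fourierDiag d := by
  have hu := fourier_mul_conjTranspose d
  refine LinearMap.ext fun X => ?_
  have htr : (conjMap (fourier d).conjTranspose X).trace = d * X.trace := by
    rw [conjMap_apply, Matrix.conjTranspose_conjTranspose, Matrix.trace_mul_comm, ← Matrix.mul_assoc,
      hu]
    simp
  have hid : conjMap (fourier d) (conjMap (fourier d).conjTranspose X) = (d ^ 2 : ℂ) • X := by
    rw [← LinearMap.comp_apply, conjMap_comp_conjMap, hu, conjMap_apply]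
    simp [smul_smul, sq]
  have hone : conjMap (fourier d) 1 = (d : ℂ) • (1 : Mat d) := by
    rw [conjMap_apply, Matrix.mul_one, hu]
  have hT : ∀ (a b c : ℂ) (Y : Mat d), threeForm d a b c Y =
      a • Y + (b * Y.trace) • 1 + c • threeForm d 0 0 1 Y := by
    intro a b c Y
    simp [threeForm]
  rw [LinearMap.comp_apply, LinearMap.comp_apply, hT α β γ, LinearMap.add_apply, hT _ _ 0]
  simp only [map_add, map_smul, hid, hone, htr, fourierDiag, LinearMap.comp_apply,
    LinearMap.smul_apply, zero_smul, add_zero, smul_smul]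
  congr 3
  · ring
  · ring

/-- Every map can be transformed by finite sums of conjugations into a map of the form
`X ↦ α X + β Tr(X) 1`, with `superTrace` and `traceOne` multiplied by the same positive number. -/
theorem exists_reach_isotropic (hd : 2 ≤ d) (L : Mat d →ₗ[ℂ] Mat d) :
    ∃ (α β : ℂ) (κ : ℝ), 0 < κ ∧ Reach L (threeForm d α β 0) ∧
      superTrace (threeForm d α β 0) = κ * superTrace L ∧
      traceOne (threeForm d α β 0) = κ * traceOne L := by
  obtain ⟨α, β, γ, h⟩ := exists_monomialTwirl_eq_threeForm hd L
  have hL := reach_monomialTwirl L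
  have h1 := superTrace_monomialTwirl L
  have h2 := traceOne_monomialTwirl L
  rw [h] at hL h1 h2
  have hd0 : (d : ℂ) ≠ 0 := by exact_mod_cast (by omega : d ≠ 0)
  have hd1 : (d : ℂ) - 1 ≠ 0 := by
    rw [sub_ne_zero]
    exact_mod_cast (by omega : d ≠ 1)
  -- The defect `superTrace + traceOne - (d + 1) diagTrace` vanishes on isotropic maps. It equals
  -- `-γ d (d - 1)` on the first summand and `γ d² (d - 1)` on the Fourier conjugate, because the
  -- two bases are mutually unbiased. The weight `1 / d` makes them cancel.
  set M := threeForm d α β γ + (((d : ℝ)⁻¹ : ℝ) : ℂ) •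
    (conjMap (fourier d) ∘ₗ threeForm d α β γ ∘ₗ conjMap (fourier d).conjTranspose) with hM
  have hLM : Reach L M := hL.add ((hL.conj _ _).smul (by positivity))
  rw [conj_fourier_threeForm] at hM
  obtain ⟨α', β', γ', h'⟩ := exists_monomialTwirl_eq_threeForm hd M
  have hM1 : superTrace M = (d + 1) * superTrace (threeForm d α β γ) := by
    simp only [hM, map_add, map_smul, superTrace_threeForm, superTrace_fourierDiag, smul_eq_mul]
    push_cast
    field_simp
    ring
  have hM2 : traceOne M = (d + 1) * traceOne (threeForm d α β γ) := by
    simp only [hM, map_add, map_smul, traceOne_threeForm, traceOne_fourierDiag, smul_eq_mul]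
    push_cast
    field_simp
    ring
  have hM3 : superTrace M + traceOne M = (d + 1) * diagTrace M := by
    rw [hM1, hM2]
    simp only [hM, map_add, map_smul, superTrace_threeForm, traceOne_threeForm,
      diagTrace_threeForm, diagTrace_fourierDiag, smul_eq_mul]
    push_cast
    field_simp
    ring
  have g1 := superTrace_monomialTwirl M
  have g2 := traceOne_monomialTwirl M
  have g3 := diagTrace_monomialTwirl M
  have hLM' := hLM.trans (reach_monomialTwirl M)
  rw [h'] at g1 g2 g3 hLM'
  -- A second monomial twirl restores the three-parameter form and only rescales the defect, which
  -- is zero. On that form the defect is `-γ' d (d - 1)`.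
  have hγ : γ' = 0 := by
    have e : superTrace (threeForm d α' β' γ') + traceOne (threeForm d α' β' γ') =
        (d + 1) * diagTrace (threeForm d α' β' γ') := by
      rw [g1, g2, g3]
      linear_combination (twirlCard d : ℂ) * hM3
    rw [superTrace_threeForm, traceOne_threeForm, diagTrace_threeForm] at e
    have e' : γ' * (d * (d - 1)) = 0 := by linear_combination -e
    exact (mul_eq_zero.mp e').resolve_right (mul_ne_zero hd0 hd1)
  subst hγ
  have hc : (0 : ℝ) < twirlCard d := by exact_mod_cast twirlCard_pos d
  refine ⟨α', β', twirlCard d * (d + 1) * twirlCard d, by positivity, hLM', ?_, ?_⟩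
  · rw [g1, hM1, h1]; push_cast; ring
  · rw [g2, hM2, h2]; push_cast; ring

end Fourier

/-! ### Adjoints and the quotient in `μ`. -/

section Adjoint

variable {a b : ℕ}

theorem hsAdjoint_conjMap (K : Matrix (Fin b) (Fin a) ℂ) :
    hsAdjoint (conjMap K) = conjMap K.conjTranspose := by
  refine LinearMap.ext fun Y => ?_
  ext i j
  have : (hsAdjoint (conjMap K) Y) i j =
      ((conjMap K (Matrix.single i j 1)).conjTranspose * Y).trace := rfl
  rw [this, conjMap_apply, conjMap_apply, Matrix.conjTranspose_mul, Matrix.conjTranspose_mul,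
    Matrix.conjTranspose_conjTranspose, Matrix.conjTranspose_single, Matrix.mul_assoc,
    Matrix.trace_mul_comm, Matrix.mul_assoc, Matrix.mul_assoc]
  simp [Matrix.mul_assoc, Matrix.trace_single_mul]

theorem hsAdjoint_sum {ι : Type} (s : Finset ι) (T : ι → (Mat a →ₗ[ℂ] Mat b)) :
    hsAdjoint (∑ x ∈ s, T x) = ∑ x ∈ s, hsAdjoint (T x) := by
  refine LinearMap.ext fun Y => ?_
  ext i j
  simp [hsAdjoint, Matrix.conjTranspose_sum, Finset.sum_mul, Matrix.trace_sum, Matrix.sum_apply]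

/-- Identifies the numerator in `μ(P)` as a functional of `T* ∘ P` that is invariant under twirling.
-/
theorem superTrace_hsAdjoint_comp {P T : Mat a →ₗ[ℂ] Mat b} (hT : IsCP T) :
    superTrace (hsAdjoint T ∘ₗ P) = (choi P * choi T).trace := by
  have hh := hT.posSemidef_choi.isHermitian
  simp only [superTrace_apply, LinearMap.comp_apply, Matrix.trace, Matrix.diag_apply,
    Matrix.mul_apply, Fintype.sum_prod_type, choi_apply P, hsAdjoint, LinearMap.coe_mk,
    AddHom.coe_mk, Matrix.of_apply, Matrix.conjTranspose_apply, ← choi_apply T, hh.apply]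
  refine Finset.sum_congr rfl fun i _ => ?_
  conv_rhs => rw [Finset.sum_comm]
  refine Finset.sum_congr rfl fun j _ => ?_
  rw [Finset.sum_comm]
  exact Finset.sum_congr rfl fun k _ => Finset.sum_congr rfl fun l _ => mul_comm _ _

theorem IsPositive.isHermitian_choi {P : Mat a →ₗ[ℂ] Mat b} (hP : IsPositive P) :
    (choi P).IsHermitian := by
  have hv : ∀ v : Fin a → ℂ, (P (Matrix.vecMulVec v (star v))).IsHermitian := fun v =>
    (hP _ (Matrix.posSemidef_vecMulVec_self_star v)).isHermitian
  have key : ∀ i j, (P (Matrix.single i j 1)).conjTranspose = P (Matrix.single j i 1) := by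
    intro i j
    have e : ∀ c : ℂ, Matrix.vecMulVec (Pi.single i 1 + c • Pi.single j 1 : Fin a → ℂ)
        (star (Pi.single i 1 + c • Pi.single j 1 : Fin a → ℂ)) =
        Matrix.single i i 1 + (c * star c) • Matrix.single j j 1 +
          (star c • Matrix.single i j (1 : ℂ) + c • Matrix.single j i (1 : ℂ)) := by
      intro c
      have hs : ∀ x y : Fin a, Matrix.vecMulVec (Pi.single x (1 : ℂ)) (Pi.single y (1 : ℂ)) =
          Matrix.single x y 1 := fun x y => by
        rw [← Matrix.single_eq_single_vecMulVec_single]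
      simp only [star_add, star_smul, Pi.star_single, star_one, Matrix.add_vecMulVec,
        Matrix.vecMulVec_add, Matrix.smul_vecMulVec, Matrix.vecMulVec_smul, hs, smul_add, smul_smul,
        mul_comm (star c)]
      abel
    have hd : ∀ i, (P (Matrix.single i i 1)).conjTranspose = P (Matrix.single i i 1) := fun i => by
      have := hv (Pi.single i 1)
      rwa [Pi.star_single, star_one, ← Matrix.single_eq_single_vecMulVec_single] at this
    have h := fun c : ℂ => (hv (Pi.single i (1 : ℂ) + c • Pi.single j (1 : ℂ))).eq
    simp only [e, map_add, map_smul, Matrix.conjTranspose_add, Matrix.conjTranspose_smul, hd,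
      star_star, star_mul'] at h
    -- With `D i j = P(|i⟩⟨j|)† - P(|j⟩⟨i|)`, the polarization identity reads `c D i j + c̄ D j i =
    -- 0`. The values `c = 1` and `c = i` together force `D i j = 0`.
    have h1 := h 1
    have h2 := h Complex.I
    ext k l
    have h1' := congrFun (congrFun h1 k) l
    have h2' := congrFun (congrFun h2 k) l
    simp at h1' h2'
    simp only [Matrix.conjTranspose_apply, Complex.star_def]
    linear_combination (1 / 2) * h1' - (Complex.I / 2) * h2' +
      (1 / 2) * ((starRingEnd ℂ) (P (Matrix.single i j 1) l k) + P (Matrix.single i j 1) k l -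
        P (Matrix.single j i 1) k l - (starRingEnd ℂ) (P (Matrix.single j i 1) l k)) *
          Complex.I_sq
  refine Matrix.IsHermitian.ext fun p q => ?_
  obtain ⟨i, k⟩ := p
  obtain ⟨j, l⟩ := q
  rw [choi_apply, choi_apply, ← key, Matrix.conjTranspose_apply, star_star]

theorem IsPositive.im_trace_choi_mul {P T : Mat a →ₗ[ℂ] Mat b} (hP : IsPositive P)
    (hT : IsCP T) : (choi P * choi T).trace.im = 0 := by
  have h1 : star (choi P * choi T).trace = (choi P * choi T).trace := by
    rw [← Matrix.trace_conjTranspose, Matrix.conjTranspose_mul, hP.isHermitian_choi.eq,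
      hT.posSemidef_choi.isHermitian.eq, Matrix.trace_mul_comm]
  exact Complex.conj_eq_iff_im.mp h1

end Adjoint

/-! ### Werner maps as transposed isotropic maps. -/

section Werner

variable {d : ℕ}

theorem trace_flip : (flip d).trace = d := by
  simp only [Matrix.trace, Matrix.diag_apply, flip, Matrix.of_apply, Fintype.sum_prod_type]
  have : ∀ i j : Fin d, (i = j ∧ j = i) ↔ i = j := fun i j => ⟨And.left, fun h => ⟨h, h.symm⟩⟩
  simp [this]

theorem trace_symProj : (symProj d).trace = d * (d + 1) / 2 := by
  rw [symProj, Matrix.trace_smul, Matrix.trace_add, trace_flip, Matrix.trace_one]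
  simp
  ring

theorem trace_asymProj : (asymProj d).trace = d * (d - 1) / 2 := by
  rw [asymProj, Matrix.trace_smul, Matrix.trace_sub, trace_flip, Matrix.trace_one]
  simp
  ring

/-- Partial transposition turns the flip into `ω`, the Choi matrix of the identity map. The
coefficients are those for which `superTrace` is `2p - 1` and `traceOne` is `1`. -/
theorem transposeMap_comp_wernerMap (hd : 2 ≤ d) (p : ℝ) :
    transposeMap d ∘ₗ wernerMap d p =
      threeForm d (((2 * p - 1) * d - 1) / (d * (d ^ 2 - 1)))
        ((d - (2 * p - 1)) / (d * (d ^ 2 - 1))) 0 := by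
  have hd0 : (d : ℂ) ≠ 0 := by exact_mod_cast (by omega : d ≠ 0)
  have hd1 : (d : ℂ) - 1 ≠ 0 := by
    rw [sub_ne_zero]
    exact_mod_cast (by omega : d ≠ 1)
  have hd2 : (d : ℂ) + 1 ≠ 0 := by exact_mod_cast (by omega : d + 1 ≠ 0)
  have hd3 : (d : ℂ) ^ 2 - 1 = (d - 1) * (d + 1) := by ring
  refine choi_injective ?_
  rw [choi_transposeMap_comp, wernerMap, choi_ofChoi]
  ext ⟨i, k⟩ ⟨j, l⟩
  rw [choi_apply, threeForm_single, hd3]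
  have hone : (1 : Matrix (Fin d × Fin d) (Fin d × Fin d) ℂ) (i, l) (j, k) =
      if i = j ∧ k = l then 1 else 0 := by
    simp [Matrix.one_apply, eq_comm (a := l)]
  have hflip : flip d (i, l) (j, k) = if i = k ∧ j = l then 1 else 0 := by
    simp [flip, eq_comm (a := l)]
  simp only [partialTranspose, Matrix.of_apply, wernerState, trace_symProj, trace_asymProj,
    Matrix.add_apply, Matrix.smul_apply, smul_eq_mul]
  simp only [symProj, asymProj, Matrix.sub_apply, Matrix.add_apply, Matrix.smul_apply,
    smul_eq_mul, hone, hflip, ite_self]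
  split_ifs
  all_goals
    field_simp
    ring

end Werner

/-! ### Reaching Werner maps from `P`. -/

section Core

variable {a b : ℕ}

theorem reach_trace {P : Mat a →ₗ[ℂ] Mat b} {t : ℝ} (ht : 0 < t) (hP : (P 1).trace = t) :
    Reach P (threeForm a 0 1 0) := by
  have h : Reach P (threeForm a 0 (P 1).trace 0) := by
    -- Conjugations by all matrix units add up to `Y ↦ Tr(Y) 1`. Placed on both sides of `P`, they
    -- give `X ↦ Tr(X) Tr(P 1) 1`.
    refine ⟨(Fin a × Fin b) × (Fin a × Fin a), inferInstance,
      fun x => Matrix.single x.1.1 x.1.2 1, fun x => Matrix.single x.2.1 x.2.2 1, ?_⟩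
    have hs : ∀ (m n : ℕ) (Y : Mat n), ∑ x : Fin m × Fin n,
        conjMap (Matrix.single x.1 x.2 (1 : ℂ)) Y = Y.trace • (1 : Mat m) := by
      intro m n Y
      have h1 : ∀ i j, conjMap (Matrix.single i j (1 : ℂ)) Y =
          Y j j • (Matrix.single i i 1 : Mat m) := fun i j => by
        rw [conjMap_apply, Matrix.conjTranspose_single, Matrix.single_mul_mul_single]
        simp
      simp only [Fintype.sum_prod_type, h1, ← Finset.sum_smul]
      rw [one_eq_sum_single, ← Finset.smul_sum]
      rfl
    refine LinearMap.ext fun X => ?_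
    rw [LinearMap.sum_apply, Fintype.sum_prod_type]
    simp only [LinearMap.comp_apply]
    simp only [← map_sum, hs, map_smul]
    rw [← Finset.smul_sum, hs]
    simp [threeForm, smul_smul, mul_comm]
  have h' := h.smul (inv_nonneg.mpr ht.le)
  rw [hP] at h'
  convert h' using 1
  refine LinearMap.ext fun X => ?_
  have ht' : (t : ℂ) ≠ 0 := by exact_mod_cast ht.ne'
  simp [threeForm, smul_smul, ht']

/-- If `2 p - 1` lies strictly between `μ(P)` and `0`, then `ϑ ∘ W_p` is a finite sum of
conjugations of `P`. -/
theorem IsPositive.reach_werner {P : Mat a →ₗ[ℂ] Mat b} (hP : IsPositive P) {p : ℝ}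
    (h1 : mu P < 2 * p - 1) (h0 : 2 * p - 1 < 0) :
    (∃ t : ℝ, 0 < t ∧ (P 1).trace = t) ∧ Reach P (transposeMap a ∘ₗ wernerMap a p) := by
  set q := 2 * p - 1 with hq
  have hne : {r : ℝ | ∃ T : Mat a →ₗ[ℂ] Mat b, IsCP T ∧ (hsAdjoint T ∘ₗ P) 1 ≠ 0 ∧
      r = (choi P * choi T).trace.re / ((hsAdjoint T ∘ₗ P) 1).trace.re}.Nonempty := by
    -- Over the empty set `sInf` has the default value `0`, which is incompatible with `μ(P) < 2p -
    -- 1 < 0`.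
    by_contra hempty
    rw [Set.not_nonempty_iff_eq_empty] at hempty
    rw [mu, hempty, Real.sInf_empty] at h1
    linarith
  obtain ⟨r, ⟨T, hT, hTP, hr⟩, hrq⟩ := exists_lt_of_csInf_lt hne h1
  obtain ⟨N, K, hK⟩ := hT.exists_kraus
  have hpos1 : (P 1).PosSemidef := hP _ Matrix.PosSemidef.one
  have hadj : hsAdjoint T ∘ₗ P = ∑ x, conjMap (K x).conjTranspose ∘ₗ P ∘ₗ conjMap 1 := by
    rw [hK, hsAdjoint_sum, sum_linearMap_comp]
    simp only [hsAdjoint_conjMap, conjMap_one, LinearMap.comp_id]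
  have hreach : Reach P (hsAdjoint T ∘ₗ P) := ⟨_, inferInstance, _, _, hadj⟩
  have hpos2 : ((hsAdjoint T ∘ₗ P) 1).PosSemidef := by
    rw [hadj, LinearMap.sum_apply]
    refine Matrix.posSemidef_sum _ fun x _ => conjMap_posSemidef _ ?_
    rwa [conjMap_one]
  have htrace : ∀ (n : ℕ) (A : Mat n), A.PosSemidef → A ≠ 0 → ∃ t : ℝ, 0 < t ∧ A.trace = t := by
    intro n A hA hA0
    have hn := Complex.le_def.mp hA.trace_nonneg
    simp only [Complex.zero_re, Complex.zero_im] at hn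
    have he : A.trace = (A.trace.re : ℂ) := Complex.ext (by simp) (by simp [← hn.2])
    refine ⟨A.trace.re, lt_of_le_of_ne hn.1 fun h => hA0 ?_, he⟩
    rw [← hA.trace_eq_zero_iff, he, ← h, Complex.ofReal_zero]
  obtain ⟨t, ht, htP⟩ := htrace _ _ hpos1 fun h => hTP (by
    rw [LinearMap.comp_apply, h, map_zero])
  refine ⟨⟨t, ht, htP⟩, ?_⟩
  obtain ⟨τ, hτ, hτP⟩ := htrace _ _ hpos2 hTP
  have hφ2 : traceOne (hsAdjoint T ∘ₗ P) = τ := by rw [traceOne_eq, hτP]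
  have hφ1 : superTrace (hsAdjoint T ∘ₗ P) = ((r * τ : ℝ) : ℂ) := by
    rw [superTrace_hsAdjoint_comp hT, hr, hτP, Complex.ofReal_re, div_mul_cancel₀ _ hτ.ne']
    exact Complex.ext (by simp) (by simp [hP.im_trace_choi_mul hT])
  -- For `a = 1` the two functionals coincide, which forces `r = 1` although `r < 0`. For `a = 0`
  -- nothing is nonzero.
  have ha : 2 ≤ a := by
    by_contra hlt
    obtain rfl | rfl : a = 0 ∨ a = 1 := by omega
    · exact hTP (Subsingleton.elim _ _)
    · have : r * τ = τ := by
        have : ((r * τ : ℝ) : ℂ) = (τ : ℂ) := by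
          rw [← hφ1, ← hφ2]
          simp [superTrace_apply, traceOne_apply]
        exact_mod_cast this
      nlinarith
  obtain ⟨α, β, κ, hκ, hL, e1, e2⟩ := exists_reach_isotropic ha (hsAdjoint T ∘ₗ P)
  replace hL := hreach.trans hL
  rw [superTrace_threeForm, hφ1] at e1
  rw [traceOne_threeForm, hφ2] at e2
  have hd : (2 : ℝ) ≤ a := by exact_mod_cast ha
  set σ := κ * τ with hσ
  have hσ0 : 0 < σ := mul_pos hκ hτ
  have hrd : 0 < 1 - r * a := by nlinarith
  have hd0 : (a : ℂ) ≠ 0 := by exact_mod_cast (by omega : a ≠ 0)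
  have hd1 : (a : ℂ) ^ 2 - 1 ≠ 0 := by
    have : (0 : ℝ) < (a : ℝ) ^ 2 - 1 := by nlinarith
    exact_mod_cast this.ne'
  have hσ' : (σ : ℂ) ≠ 0 := by exact_mod_cast hσ0.ne'
  have hrd' : 1 - (a : ℂ) * r ≠ 0 := by
    rw [mul_comm]
    exact_mod_cast hrd.ne'
  have hσC : (σ : ℂ) = κ * τ := by rw [hσ]; push_cast; rfl
  have hα : α = σ * (r * a - 1) / (a * (a ^ 2 - 1)) := by
    rw [eq_div_iff (mul_ne_zero hd0 hd1), hσC]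
    push_cast at e1
    linear_combination a * e1 - e2
  have hβ : β = σ * (a - r) / (a * (a ^ 2 - 1)) := by
    rw [eq_div_iff (mul_ne_zero hd0 hd1), hσC]
    push_cast at e1
    linear_combination a * e2 - e1
  -- The pair `(superTrace, traceOne)` is `(σ r, σ)` for the twirled map, `(a, a²)` for `X ↦ Tr(X)
  -- 1` and `(q, 1)` for the target. The weights solve the resulting linear system. They are
  -- nonnegative because `r < q < 0`.
  have hs : 0 ≤ (1 - q * a) / (σ * (1 - r * a)) := by
    have : 0 < 1 - q * a := by nlinarith
    positivity
  have hc : 0 ≤ (q - r) / (a * (1 - r * a)) :=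
    div_nonneg (by linarith) (mul_nonneg (by linarith) hrd.le)
  have key := (hL.smul hs).add ((reach_trace ht htP).smul hc)
  convert key using 1
  rw [transposeMap_comp_wernerMap ha]
  have hqC : 2 * (p : ℂ) - 1 = q := by rw [hq]; push_cast; rfl
  refine LinearMap.ext fun X => ?_
  ext k l
  simp only [LinearMap.add_apply, LinearMap.smul_apply, Matrix.add_apply, Matrix.smul_apply,
    threeForm_apply_entry, smul_eq_mul, hα, hβ, hqC]
  push_cast
  rw [mul_comm (r : ℂ)]
  split_ifs
  · field_simp
    ring
  · field_simp
    ring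

theorem IsMappingCone.mixedWerner_mem {C : ∀ n m : ℕ, ConvexCone ℝ (Mat n →ₗ[ℂ] Mat m)}
    (hC : IsMappingCone C) {P : Mat a →ₗ[ℂ] Mat b} (hP : IsPositive P) {N n m : ℕ}
    (hN : tensorPower N P ∈ C (a ^ N) (b ^ N)) (hnm : n + m ≤ N) {p₁ p₂ : ℝ}
    (h₁ : (1 / 2) * (1 + mu (transposeMap b ∘ₗ P)) < p₁) (h₁' : p₁ < 1 / 2)
    (h₂ : (1 / 2) * (1 + mu P) < p₂) (h₂' : p₂ < 1 / 2) :
    mixedWerner a n m p₁ p₂ ∈ C (a ^ (n + m)) (a ^ (n + m)) := by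
  obtain ⟨⟨t, ht, htP⟩, hW₂⟩ := hP.reach_werner (p := p₂) (by linarith) (by linarith)
  -- Applied to `ϑ ∘ P`, the previous result reaches `ϑ ∘ W_{p₁}`; moving `ϑ` across then gives
  -- `W_{p₁}` itself from `P`.
  have hW₁ : Reach P (wernerMap a p₁) :=
    (hP.transposeMap_comp.reach_werner (p := p₁) (by linarith)
      (by linarith)).2.of_transposeMap_comp
  refine hC.mem_of_reach hN ((reach_tensorPower_le ht htP hnm).trans
    (reach_tensorFamily fun s => ?_))
  refine Fin.addCases (fun i => ?_) (fun i => ?_) s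
  · rw [Fin.append_left]
    exact hW₁
  · rw [Fin.append_right]
    exact hW₂

end Core

end MatMap

theorem mainTheorem4 :
    -- reduction to Werner maps for an arbitrary mapping cone
    (∀ (C : ∀ n m : ℕ, ConvexCone ℝ (Mat n →ₗ[ℂ] Mat m)), MatMap.IsMappingCone C →
      ∀ (dA dB : ℕ) (P : Mat dA →ₗ[ℂ] Mat dB),
        MatMap.IsPositive P → ¬ MatMap.IsCP P → ¬ MatMap.IsCoCP P →
      ∀ N : ℕ, MatMap.tensorPower N P ∈ C (dA ^ N) (dB ^ N) →
      ∀ n m : ℕ, n + m ≤ N →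
      ∀ p₁ p₂ : ℝ,
        (1 / 2) * (1 + MatMap.mu (MatMap.transposeMap dB ∘ₗ P)) < p₁ → p₁ < 1 / 2 →
        (1 / 2) * (1 + MatMap.mu P) < p₂ → p₂ < 1 / 2 →
        MatMap.mixedWerner dA n m p₁ p₂ ∈ C (dA ^ (n + m)) (dA ^ (n + m))) ∧
    -- the decomposable maps form a mapping cone
    MatMap.IsMappingCone MatMap.decomposableCone ∧
    -- reduction to Werner maps for decomposability
    (∀ (dA dB : ℕ) (P : Mat dA →ₗ[ℂ] Mat dB),
        MatMap.IsPositive P → ¬ MatMap.IsCP P → ¬ MatMap.IsCoCP P →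
      ∀ N : ℕ, MatMap.IsDecomposable (MatMap.tensorPower N P) →
      ∀ n m : ℕ, n + m ≤ N →
      ∀ p₁ p₂ : ℝ,
        (1 / 2) * (1 + MatMap.mu (MatMap.transposeMap dB ∘ₗ P)) < p₁ → p₁ < 1 / 2 →
        (1 / 2) * (1 + MatMap.mu P) < p₂ → p₂ < 1 / 2 →
        MatMap.IsDecomposable (MatMap.mixedWerner dA n m p₁ p₂)) := by
  refine ⟨?_, MatMap.isMappingCone_decomposableCone, ?_⟩
  · intro C hC dA dB P hP _ _ N hN n m hnm p₁ p₂ h₁ h₁' h₂ h₂'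
    exact hC.mixedWerner_mem hP hN hnm h₁ h₁' h₂ h₂'
  · intro dA dB P hP _ _ N hN n m hnm p₁ p₂ h₁ h₁' h₂ h₂'
    exact MatMap.isMappingCone_decomposableCone.mixedWerner_mem hP hN hnm h₁ h₁' h₂ h₂'
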